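/- Let $d=2d_1$, let $H:\mathbb{R}^d\to\mathbb{R}$ be of class $C^{r+2}$, and put $f=J^{-1}\nabla H$ with $J=\begin{pmatrix}0&I\\-I&0\end{pmatrix}$. Let $y$ solve $y'(t)=f(y(t))$, $y(t_0)=y_0$, on $[t_0,T]$, where $T>t_0$. Let $\varphi_0,\dots,\varphi_{r-1}:\mathbb{R}\to\mathbb{R}$ be linearly independent functions of class $C^r$ such that $Y=\{\sum_{i}W_i\varphi_i : W_i\in\mathbb{R}^d\}$ is invariant under the translations $v(t)\mapsto v(t+c)$, $c\in\mathbb{R}$, and under the reflection $v(t)\mapsto v(-t)$. Let $X=\{V+\sum_i W_i\int_{t_0}^t\varphi_i(s)\,ds : V,W_i\in\mathbb{R}^d\}$. For $h>0$ let $X_h$ and $Y_h$ be the sets of the functions $\tau\mapsto w(t_0+\tau h)$ with $w\in X$ and $w\in Y$, respectively. With $\langle v,w\rangle=\int_0^1 v(\tau)\cdot w(\tau)\,d\tau$ (entrywise product, so that $\langle v,w\rangle\in\mathbb{R}^d$), one step of the functionally-fitted continuous finite element method FFCFE$r$ is: find $u\in X_h$ with $u(0)=y_0$ and $$\langle v,u'\rangle=h\,\langle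 v,f\circ u\rangle\quad\text{for all }v\in Y_h. \tag{1}$$ Its continuous-stage Runge--Kutta form is: find a continuous $u$ on $[0,1]$ with $$u(\tau)=y_0+h\int_0^1A_{\tau,\sigma}f(u(\sigma))\,d\sigma,\qquad A_{\tau,\sigma}=\int_0^\tau\sum_{i,j}\varphi_i(t_0+\alpha h)\,(M^{-1})_{ij}\,\varphi_j(t_0+\sigma h)\,d\alpha, \tag{2}$$ where $M_{ij}=\int_0^1\varphi_i(t_0+\tau h)\varphi_j(t_0+\tau h)\,d\tau$. Then for every $R>0$ there are $h_0\in(0,T-t_0]$ and a constant $C$ such that for every $0<h\le h_0$ there is a function $u$ that solves both (1) and (2), satisfies $\|u(\tau)-y_0\|\le R$ on $[0,1]$, and agrees on $[0,1]$ with every solution of (1) or of (2) that satisfies this bound; moreover $$\|u(\tau)-y(t_0+\tau h)\|\le C\,h^{r+1}\quad(0<\tau<1),\qquad \|u(1)-y(t_0+h)\|\le C\,h^{2r+1}.$$ That is, the method has stage order $r$ and order $2r$. -/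

import Mathlib

open scoped Matrix

noncomputable section

namespace FFCFE

/-- The phase space `ℝ^d`, `d = 2 d₁`; the index type `Fin d₁ ⊕ Fin d₁` exhibits the two blocks. -/
abbrev Phase (d₁ : ℕ) : Type := EuclideanSpace ℝ (Fin d₁ ⊕ Fin d₁)

/-- The canonical symplectic matrix `J = [[O, I], [-I, O]]`. -/
def symplecticJ (d₁ : ℕ) : Matrix (Fin d₁ ⊕ Fin d₁) (Fin d₁ ⊕ Fin d₁) ℝ :=
  Matrix.fromBlocks 0 1 (-1) 0

/-- The Hamiltonian vector field `f(y) = J⁻¹ ∇H(y)`. -/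
def hamiltonianField {d₁ : ℕ} (H : Phase d₁ → ℝ) (y : Phase d₁) : Phase d₁ :=
  WithLp.toLp 2 ((symplecticJ d₁)⁻¹ *ᵥ (WithLp.ofLp (gradient H y)))

/-- `y` solves `y'(t) = f(y(t))`, `y(t₀) = y₀` on `[t₀, T]` (one-sided derivatives at the ends). -/
def IsIVPSolution {d₁ : ℕ} (f : Phase d₁ → Phase d₁) (t₀ T : ℝ) (y₀ : Phase d₁)
    (y : ℝ → Phase d₁) : Prop :=
  y t₀ = y₀ ∧
    ∀ t ∈ Set.Icc t₀ T, HasDerivWithinAt y (f (y t)) (Set.Icc t₀ T) t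

/-- `Y = span{φ₀, …, φ_{r-1}}` with coefficients in `ℝ^d`. -/
def spaceY (d₁ : ℕ) {r : ℕ} (φ : Fin r → ℝ → ℝ) : Set (ℝ → Phase d₁) :=
  {w | ∃ W : Fin r → Phase d₁, ∀ t, w t = ∑ i, φ i t • W i}

/-- `X = span{1, ∫_{t₀}^t φ₀, …, ∫_{t₀}^t φ_{r-1}}` with coefficients in `ℝ^d`. -/
def spaceX (d₁ : ℕ) {r : ℕ} (φ : Fin r → ℝ → ℝ) (t₀ : ℝ) : Set (ℝ → Phase d₁) :=
  {w | ∃ (V : Phase d₁) (W : Fin r → Phase d₁),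
    ∀ t, w t = V + ∑ i, (∫ s in t₀..t, φ i s) • W i}

/-- `S_h(t₀) = {v : v(τ) = w(t₀ + τ h), w ∈ S}`. -/
def rescale {d₁ : ℕ} (S : Set (ℝ → Phase d₁)) (t₀ h : ℝ) : Set (ℝ → Phase d₁) :=
  {v | ∃ w ∈ S, ∀ τ, v τ = w (t₀ + τ * h)}

/-- Invariance of a function space under translation and reflection. -/
def TranslationReflectionInvariant {d₁ : ℕ} (S : Set (ℝ → Phase d₁)) : Prop :=
  (∀ v ∈ S, ∀ c : ℝ, (fun t => v (t + c)) ∈ S) ∧ (∀ v ∈ S, (fun t => v (-t)) ∈ S)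

/-- `⟨w₁, w₂⟩ = ∫₀¹ w₁(τ) · w₂(τ) dτ`, with the entrywise product, a vector in `ℝ^d`. -/
def pairing {d₁ : ℕ} (w₁ w₂ : ℝ → Phase d₁) : Phase d₁ :=
  WithLp.toLp 2 (fun j => ∫ τ in (0 : ℝ)..1, w₁ τ j * w₂ τ j)

/-- One step of the method in variational form: `u ∈ X_h(t₀)`, `u(0) = y₀` and
`⟨v, u'⟩ = h ⟨v, f ∘ u⟩` for all `v ∈ Y_h(t₀)`. -/
def IsVariationalSolution {d₁ r : ℕ} (φ : Fin r → ℝ → ℝ) (f : Phase d₁ → Phase d₁)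
    (t₀ h : ℝ) (y₀ : Phase d₁) (u : ℝ → Phase d₁) : Prop :=
  u ∈ rescale (spaceX d₁ φ t₀) t₀ h ∧ u 0 = y₀ ∧
    ∀ v ∈ rescale (spaceY d₁ φ) t₀ h, pairing v (deriv u) = h • pairing v (f ∘ u)

/-- The Gram matrix `M` of `τ ↦ φ_i(t₀ + τ h)` in `L²(0,1)`. -/
def gram {r : ℕ} (φ : Fin r → ℝ → ℝ) (t₀ h : ℝ) : Matrix (Fin r) (Fin r) ℝ :=
  Matrix.of fun i j => ∫ τ in (0 : ℝ)..1, φ i (t₀ + τ * h) * φ j (t₀ + τ * h)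

/-- The kernel `P_{τ,σ}` of the projection onto `Y_h`. -/
def kernelP {r : ℕ} (φ : Fin r → ℝ → ℝ) (t₀ h τ σ : ℝ) : ℝ :=
  (fun i => φ i (t₀ + τ * h)) ⬝ᵥ ((gram φ t₀ h)⁻¹ *ᵥ fun i => φ i (t₀ + σ * h))

/-- The continuous-stage Runge-Kutta coefficient `A_{τ,σ} = ∫₀^τ P_{α,σ} dα`. -/
def coeffA {r : ℕ} (φ : Fin r → ℝ → ℝ) (t₀ h τ σ : ℝ) : ℝ :=
  ∫ α in (0 : ℝ)..τ, kernelP φ t₀ h α σ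

/-- One step of the method in continuous-stage Runge-Kutta form:
`u(τ) = y₀ + h ∫₀¹ A_{τ,σ} f(u(σ)) dσ` on `[0,1]`. -/
def IsContinuousStageSolution {d₁ r : ℕ} (φ : Fin r → ℝ → ℝ) (f : Phase d₁ → Phase d₁)
    (t₀ h : ℝ) (y₀ : Phase d₁) (u : ℝ → Phase d₁) : Prop :=
  ContinuousOn u (Set.Icc 0 1) ∧
    ∀ τ ∈ Set.Icc (0 : ℝ) 1,
      u τ = y₀ + h • ∫ σ in (0 : ℝ)..1, coeffA φ t₀ h τ σ • f (u σ)

end FFCFE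

end

namespace FFCFE

/-! ### Translation-invariant spans -/

/-! Let `P_h` be the `L²(0,1)`-projection onto the rescaled span of the `φ i`. Both forms of the
method say `u(τ) = y₀ + h ∫₀^τ P_h(f ∘ u)`, so everything rests on a bound for `P_h` that is uniform
as `h → 0`, although the Gram matrix tends to one of rank at most 1.

Translation invariance makes the span closed under differentiation, so `x = (φ i)` solves a
constant-coefficient system `x' = D x`. By Cayley-Hamilton and ODE uniqueness, linear independence
makes the Wronskian invertible at `t₀`, which yields a basis of the form `(t - t₀)^k + O((t -
t₀)^r)`, `k < r`. Rescaled by `h^(-k)`, it tends to the monomials `τ^k`, whose Gram matrix is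
invertible. Since the projection kernel does not depend on the basis, it is bounded by some `K` for
all small `h` (`exists_kernel_bound`). The same basis approximates any `C^r` function to order `r`
(`exists_approx`).

Existence and local uniqueness follow by contraction. For the stages, `P_h` fixes the span and is
bounded, so the defect of `f ∘ y` is `O(h^r)`; integration gains a factor `h` (`stage_error_le`).

The order `2r` at the endpoint is a duality argument (`weighted_endpoint_error_le`). Let `e` be the
error and `A = Df(y)`, and let `Z` nearly solve the adjoint equation `Z' = -Z A`, `Z(t₀) = 1`. The
derivative of `Z e` consists of a small residual, a term quadratic in `e`, and `Z` applied to the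
defect `P_h(f ∘ u) - f ∘ u`. That defect is orthogonal to the span, so `Z` may be replaced by its
distance `O(h^r)` to the span. The product of two `O(h^r)` factors, times `h`, gives `h^(2r+1)`. -/

theorem exists_translate_eq_sum {d₁ r : ℕ} (hd : 0 < d₁) {φ : Fin r → ℝ → ℝ}
    (hinv : TranslationReflectionInvariant (spaceY d₁ φ)) (i : Fin r) (c : ℝ) :
    ∃ b : Fin r → ℝ, ∀ t, φ i (t + c) = ∑ k, b k * φ k t := by
  classical
  -- A single coordinate direction carries the vector-valued invariance back to the scalar
  -- functions; it exists because `d₁ > 0`.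
  let j₀ : Fin d₁ ⊕ Fin d₁ := Sum.inl ⟨0, hd⟩
  have hmem : (fun t => φ i t • (EuclideanSpace.single j₀ (1 : ℝ) : Phase d₁)) ∈ spaceY d₁ φ := by
    refine ⟨Pi.single i (EuclideanSpace.single j₀ (1 : ℝ)), fun t => ?_⟩
    rw [Finset.sum_eq_single i]
    · simp
    · intro b _ hb
      simp [Pi.single_eq_of_ne hb]
    · simp
  obtain ⟨W, hW⟩ := hinv.1 _ hmem c
  refine ⟨fun k => W k j₀, fun t => ?_⟩
  have h := congrArg (fun v : Phase d₁ => v j₀) (hW t)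
  simpa [mul_comm] using h

/-- Difference quotients of `φ i` stay in the span and converge pointwise to the derivative; a
finite-dimensional subspace is closed for pointwise convergence. -/
theorem deriv_mem_span_of_translation_invariant {r : ℕ} {φ : Fin r → ℝ → ℝ}
    (hd : ∀ i, Differentiable ℝ (φ i))
    (htr : ∀ (i : Fin r) (c : ℝ), ∃ b : Fin r → ℝ, ∀ t, φ i (t + c) = ∑ k, b k * φ k t)
    (i : Fin r) : deriv (φ i) ∈ Submodule.span ℝ (Set.range φ) := by
  set V := Submodule.span ℝ (Set.range φ)
  have hfin : FiniteDimensional ℝ V := FiniteDimensional.span_of_finite ℝ (Set.finite_range φ)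
  have hclosed : IsClosed (V : Set (ℝ → ℝ)) := Submodule.closed_of_finiteDimensional V
  have hφ : ∀ k, φ k ∈ V := fun k => Submodule.subset_span ⟨k, rfl⟩
  have hlim : Filter.Tendsto (fun c : ℝ => fun t => c⁻¹ • (φ i (t + c) - φ i t))
      (nhdsWithin 0 {0}ᶜ) (nhds (deriv (φ i))) := by
    rw [tendsto_pi_nhds]
    exact fun t => (hd i t).hasDerivAt.tendsto_slope_zero
  refine hclosed.mem_of_tendsto hlim (Filter.Eventually.of_forall fun c => ?_)
  obtain ⟨b, hb⟩ := htr i c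
  have : (fun t => c⁻¹ • (φ i (t + c) - φ i t)) = c⁻¹ • (∑ k, b k • φ k - φ i) := by
    funext t
    simp [hb t]
  rw [this]
  exact V.smul_mem _ (V.sub_mem (V.sum_mem fun k _ => V.smul_mem _ (hφ k)) (hφ i))

theorem exists_matrix_hasDerivAt {r : ℕ} {φ : Fin r → ℝ → ℝ}
    (hd : ∀ i, Differentiable ℝ (φ i))
    (htr : ∀ (i : Fin r) (c : ℝ), ∃ b : Fin r → ℝ, ∀ t, φ i (t + c) = ∑ k, b k * φ k t) :
    ∃ D : Matrix (Fin r) (Fin r) ℝ,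
      ∀ t, HasDerivAt (fun s => fun i => φ i s) (D *ᵥ fun i => φ i t) t := by
  have h := fun i => (Submodule.mem_span_range_iff_exists_fun ℝ).1
    (deriv_mem_span_of_translation_invariant hd htr i)
  choose D hD using h
  refine ⟨Matrix.of D, fun t => hasDerivAt_pi.2 fun i => ?_⟩
  have h1 := (hd i t).hasDerivAt
  rw [← hD i] at h1
  simpa [Matrix.mulVec, dotProduct] using h1

/-! ### The Wronskian -/

section Wronskian

variable {r : ℕ} {D : Matrix (Fin r) (Fin r) ℝ} {x : ℝ → Fin r → ℝ}

theorem hasDerivAt_pow_mulVec (hx : ∀ t, HasDerivAt x (D *ᵥ x t) t) (n : ℕ) (c : Fin r → ℝ)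
    (t : ℝ) : HasDerivAt (fun s => c ⬝ᵥ (D ^ n *ᵥ x s)) (c ⬝ᵥ (D ^ (n + 1) *ᵥ x t)) t := by
  have hL : ∀ v, c ⬝ᵥ (D ^ n *ᵥ v) =
      (LinearMap.toContinuousLinearMap ((dotProductBilin ℝ ℝ c).comp (D ^ n).mulVecLin)) v := by
    intro v
    simp [dotProductBilin]
  simp only [pow_succ, ← Matrix.mulVec_mulVec]
  simp only [hL]
  exact (ContinuousLinearMap.hasFDerivAt _).comp_hasDerivAt t (hx t)

/-- Cayley-Hamilton: `X ^ n` is reduced modulo the characteristic polynomial, leaving degree below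
`r`. -/
theorem exists_pow_mulVec_eq_sum (D : Matrix (Fin r) (Fin r) ℝ) (c : Fin r → ℝ) (n : ℕ) :
    ∃ a : Fin r → ℝ, ∀ v, c ⬝ᵥ (D ^ n *ᵥ v) = ∑ k : Fin r, a k * c ⬝ᵥ (D ^ (k : ℕ) *ᵥ v) := by
  rcases Nat.eq_zero_or_pos r with rfl | hr
  · exact ⟨0, fun v => by simp⟩
  have : Nonempty (Fin r) := ⟨⟨0, hr⟩⟩
  have hdeg : (Polynomial.X ^ n %ₘ D.charpoly).natDegree < r := by
    have := Polynomial.natDegree_modByMonic_lt (Polynomial.X ^ n) D.charpoly_monic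
      (fun h => by
        have := D.charpoly_natDegree_eq_dim
        rw [h] at this
        simp at this
        omega)
    simpa using this
  refine ⟨fun k => (Polynomial.X ^ n %ₘ D.charpoly).coeff k, fun v => ?_⟩
  rw [Matrix.pow_eq_aeval_mod_charpoly, Polynomial.aeval_eq_sum_range' hdeg,
    Matrix.sum_mulVec, dotProduct_sum, Finset.sum_range]
  exact Finset.sum_congr rfl fun j _ => by rw [Matrix.smul_mulVec, dotProduct_smul, smul_eq_mul]

/-- By Cayley-Hamilton the functions `c ⬝ᵥ D ^ j x`, `j < r`, satisfy a closed linear system. Zero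
initial data force the zero solution, and the component `j = 0` is the claim. -/
theorem dotProduct_eq_zero_of_jet_eq_zero (hx : ∀ t, HasDerivAt x (D *ᵥ x t) t) {t₀ : ℝ}
    {c : Fin r → ℝ} (h0 : ∀ j : Fin r, c ⬝ᵥ (D ^ (j : ℕ) *ᵥ x t₀) = 0) (t : ℝ) :
    c ⬝ᵥ x t = 0 := by
  rcases Nat.eq_zero_or_pos r with rfl | hr
  · simp
  choose a ha using fun j : Fin r => exists_pow_mulVec_eq_sum D c (j + 1)
  let L : (Fin r → ℝ) →L[ℝ] (Fin r → ℝ) :=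
    LinearMap.toContinuousLinearMap (Matrix.of a).mulVecLin
  have hzero : (fun s => fun j : Fin r => c ⬝ᵥ (D ^ (j : ℕ) *ᵥ x s)) = 0 := by
    refine ODE_solution_unique_univ (v := fun _ => L) (s := fun _ => Set.univ) (t₀ := t₀)
      (fun _ => L.lipschitz.lipschitzOnWith) (fun s => ⟨hasDerivAt_pi.2 fun j => ?_, trivial⟩)
      (fun s => ⟨by simp, trivial⟩) (funext h0)
    have h := hasDerivAt_pow_mulVec hx j c s
    rw [ha] at h
    simpa [L, Matrix.mulVec, dotProduct] using h
  simpa using congrFun (congrFun hzero t) ⟨0, hr⟩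

/-- The columns `D ^ j x(t₀)` are the derivatives of `x` at `t₀`, so this is the Wronskian matrix; a
left null vector would be a linear relation among the functions. -/
theorem isUnit_det_jet (hx : ∀ t, HasDerivAt x (D *ᵥ x t) t)
    (hli : LinearIndependent ℝ fun i t => x t i) (t₀ : ℝ) :
    IsUnit (Matrix.of fun i (j : Fin r) => (D ^ (j : ℕ) *ᵥ x t₀) i).det := by
  rw [← Matrix.isUnit_iff_isUnit_det, ← Matrix.vecMul_injective_iff_isUnit]
  refine (injective_iff_map_eq_zero (Matrix.vecMulLinear _)).2 fun c hc => ?_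
  have h0 : ∀ j : Fin r, c ⬝ᵥ (D ^ (j : ℕ) *ᵥ x t₀) = 0 := fun j => congrFun hc j
  have h1 := dotProduct_eq_zero_of_jet_eq_zero hx h0
  funext i
  refine Fintype.linearIndependent_iff.1 hli c (funext fun t => ?_) i
  simpa [dotProduct] using h1 t

theorem iteratedDerivWithin_dotProduct (hx : ∀ t, HasDerivAt x (D *ᵥ x t) t) {s : Set ℝ}
    (hs : UniqueDiffOn ℝ s) (c : Fin r → ℝ) (n : ℕ) {t : ℝ} (ht : t ∈ s) :
    iteratedDerivWithin n (fun u => c ⬝ᵥ x u) s t = c ⬝ᵥ (D ^ n *ᵥ x t) := by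
  induction n generalizing t with
  | zero => simp
  | succ n ih =>
    rw [iteratedDerivWithin_succ, derivWithin_congr (fun u hu => ih hu) (ih ht)]
    exact (hasDerivAt_pow_mulVec hx n c t).hasDerivWithinAt.derivWithin (hs t ht)

end Wronskian

/-! ### Bases adapted to a point -/

theorem exists_taylor_bound {E : Type*} [NormedAddCommGroup E] [NormedSpace ℝ E] {r : ℕ}
    {g : ℝ → E} {a b : ℝ} (hab : a ≤ b) (hg : ContDiffOn ℝ r g (Set.Icc a b)) :
    ∃ C, 0 ≤ C ∧ ∀ t ∈ Set.Icc a b, ‖g t - ∑ k : Fin r, (t - a) ^ (k : ℕ) •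
      ((k : ℕ).factorial : ℝ)⁻¹ • iteratedDerivWithin k g (Set.Icc a b) a‖ ≤ C * (t - a) ^ r := by
  suffices h : ∃ C, ∀ t ∈ Set.Icc a b, ‖g t - ∑ k : Fin r, (t - a) ^ (k : ℕ) •
      ((k : ℕ).factorial : ℝ)⁻¹ • iteratedDerivWithin k g (Set.Icc a b) a‖ ≤ C * (t - a) ^ r by
    obtain ⟨C, hC⟩ := h
    refine ⟨|C|, abs_nonneg C, fun t ht => (hC t ht).trans ?_⟩
    exact mul_le_mul_of_nonneg_right (le_abs_self C) (pow_nonneg (sub_nonneg.2 ht.1) r)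
  cases r with
  -- For `r = 0` the Taylor sum is empty and only boundedness is claimed; otherwise its `r = n + 1`
  -- terms form the Taylor polynomial of degree `n`.
  | zero =>
    obtain ⟨C, hC⟩ := isCompact_Icc.exists_bound_of_continuousOn hg.continuousOn
    exact ⟨C, fun t ht => by simpa using hC t ht⟩
  | succ n =>
    obtain ⟨C, hC⟩ := exists_taylor_mean_remainder_bound hab (by simpa using hg)
    refine ⟨C, fun t ht => ?_⟩
    have h := hC t ht
    rw [taylor_within_apply, Finset.sum_range] at h
    simpa only [mul_comm _ ((t - a) ^ _), mul_smul] using h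

/-- With `Q` the Wronskian matrix and `F = diag(k!)`, the choice `S = F Q⁻¹` gives the `k`-th new
function the derivatives `k! δ_jk` at `t₀`. Its Taylor polynomial of degree below `r` is then
exactly `(t - t₀)^k`. -/
theorem exists_monomial_like_basis {r : ℕ} {φ : Fin r → ℝ → ℝ}
    (hφ : ∀ i, ContDiff ℝ r (φ i)) (hli : LinearIndependent ℝ φ)
    (htr : ∀ (i : Fin r) (c : ℝ), ∃ b : Fin r → ℝ, ∀ t, φ i (t + c) = ∑ k, b k * φ k t)
    (t₀ : ℝ) :
    ∃ S : Matrix (Fin r) (Fin r) ℝ, IsUnit S.det ∧ ∃ C, 0 ≤ C ∧ ∀ k, ∀ t ∈ Set.Icc t₀ (t₀ + 1),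
      |(S *ᵥ fun i => φ i t) k - (t - t₀) ^ (k : ℕ)| ≤ C * (t - t₀) ^ r := by
  have hdiff : ∀ i, Differentiable ℝ (φ i) := fun i =>
    (hφ i).differentiable (by have := i.pos; exact_mod_cast this.ne')
  obtain ⟨D, hD⟩ := exists_matrix_hasDerivAt hdiff htr
  have hQ := isUnit_det_jet hD hli t₀
  set Q := Matrix.of fun i (j : Fin r) => (D ^ (j : ℕ) *ᵥ fun i => φ i t₀) i with hQdef
  let F : Matrix (Fin r) (Fin r) ℝ := Matrix.diagonal fun k => ((k : ℕ).factorial : ℝ)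
  have hF : IsUnit F.det := by
    rw [Matrix.det_diagonal, isUnit_iff_ne_zero]
    exact Finset.prod_ne_zero_iff.2 fun k _ => by positivity
  refine ⟨F * Q⁻¹, ?_, ?_⟩
  · rw [Matrix.det_mul]
    exact hF.mul (Matrix.isUnit_nonsing_inv_det Q hQ)
  have hSQ : F * Q⁻¹ * Q = F := by rw [mul_assoc, Matrix.nonsing_inv_mul _ hQ, mul_one]
  set S := F * Q⁻¹
  have hab : t₀ < t₀ + 1 := by linarith
  have hsmooth : ∀ k, ContDiffOn ℝ r (fun t => S k ⬝ᵥ fun i => φ i t)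
      (Set.Icc t₀ (t₀ + 1)) := fun k => by
    simp only [dotProduct]
    exact (ContDiff.sum fun i _ => contDiff_const.mul (hφ i)).contDiffOn
  choose C hC0 hC using fun k => exists_taylor_bound hab.le (hsmooth k)
  refine ⟨∑ k, C k, Finset.sum_nonneg fun k _ => hC0 k, fun k t ht => ?_⟩
  have h := hC k t ht
  have hsum : ∑ j : Fin r, (t - t₀) ^ (j : ℕ) • ((j : ℕ).factorial : ℝ)⁻¹ •
      iteratedDerivWithin j (fun t => S k ⬝ᵥ fun i => φ i t) (Set.Icc t₀ (t₀ + 1)) t₀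
      = (t - t₀) ^ (k : ℕ) := by
    have hjet : ∀ j : Fin r, iteratedDerivWithin j (fun t => S k ⬝ᵥ fun i => φ i t)
        (Set.Icc t₀ (t₀ + 1)) t₀ = F k j := fun j => by
      rw [iteratedDerivWithin_dotProduct hD (uniqueDiffOn_Icc hab) _ _ (Set.left_mem_Icc.2 hab.le),
        ← hSQ]
      rfl
    rw [Finset.sum_eq_single k]
    · rw [hjet]
      have : ((k : ℕ).factorial : ℝ) ≠ 0 := by positivity
      simp [F, this]
    · intro j _ hj
      rw [hjet]
      simp [F, Matrix.diagonal_apply_ne _ hj.symm]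
    · simp
  rw [hsum, Real.norm_eq_abs] at h
  refine h.trans (mul_le_mul_of_nonneg_right ?_ (pow_nonneg (sub_nonneg.2 ht.1) r))
  exact Finset.single_le_sum (f := C) (fun k _ => hC0 k) (Finset.mem_univ k)

/-! ### Gram matrices -/

/-- The Gram matrix in `L²(0,1)` of a finite family of functions. -/
noncomputable def gramMatrix {r : ℕ} (e : Fin r → ℝ → ℝ) : Matrix (Fin r) (Fin r) ℝ :=
  Matrix.of fun i j => ∫ τ in (0 : ℝ)..1, e i τ * e j τ

theorem gram_eq_gramMatrix {r : ℕ} (φ : Fin r → ℝ → ℝ) (t₀ h : ℝ) :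
    gram φ t₀ h = gramMatrix fun i τ => φ i (t₀ + τ * h) := rfl

theorem gramMatrix_mulVec {r : ℕ} {e : Fin r → ℝ → ℝ} (he : ∀ i, Continuous (e i))
    (S : Matrix (Fin r) (Fin r) ℝ) :
    gramMatrix (fun k τ => (S *ᵥ fun i => e i τ) k) = S * gramMatrix e * Sᵀ := by
  ext k l
  simp only [gramMatrix, Matrix.of_apply, Matrix.mul_apply, Matrix.mulVec, dotProduct,
    Matrix.transpose_apply, Finset.sum_mul]
  have h1 : ∀ τ, ∑ i, S k i * e i τ * ∑ j, S l j * e j τ =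
      ∑ j, ∑ i, S k i * (e i τ * e j τ) * S l j := fun τ => by
    rw [Finset.sum_comm]
    refine Finset.sum_congr rfl fun i _ => ?_
    rw [Finset.mul_sum]
    exact Finset.sum_congr rfl fun j _ => by ring
  simp only [h1]
  have hc : ∀ i j, Continuous fun τ => S k i * (e i τ * e j τ) * S l j := fun i j => by
    have := he i
    have := he j
    fun_prop
  rw [intervalIntegral.integral_finsetSum
    fun j _ => (continuous_finsetSum _ fun i _ => hc i j).intervalIntegrable _ _]
  refine Finset.sum_congr rfl fun j _ => ?_
  rw [intervalIntegral.integral_finsetSum fun i _ => (hc i j).intervalIntegrable _ _]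
  refine Finset.sum_congr rfl fun i _ => ?_
  rw [intervalIntegral.integral_mul_const, intervalIntegral.integral_const_mul]

theorem dotProduct_gramMatrix_mulVec {r : ℕ} {e : Fin r → ℝ → ℝ} (he : ∀ i, Continuous (e i))
    (c : Fin r → ℝ) :
    c ⬝ᵥ (gramMatrix e *ᵥ c) = ∫ τ in (0 : ℝ)..1, (∑ i, c i * e i τ) ^ 2 := by
  have h1 : ∀ τ, (∑ i, c i * e i τ) ^ 2 = ∑ i, ∑ j, c i * (e i τ * e j τ * c j) := fun τ => by
    rw [sq, Finset.sum_mul]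
    refine Finset.sum_congr rfl fun i _ => ?_
    rw [Finset.mul_sum]
    exact Finset.sum_congr rfl fun j _ => by ring
  have hc : ∀ i j, Continuous fun τ => c i * (e i τ * e j τ * c j) := fun i j => by
    have := he i
    have := he j
    fun_prop
  simp only [h1]
  rw [intervalIntegral.integral_finsetSum
    fun i _ => (continuous_finsetSum _ fun j _ => hc i j).intervalIntegrable _ _]
  simp only [dotProduct, Matrix.mulVec, gramMatrix, Matrix.of_apply, Finset.mul_sum]
  refine Finset.sum_congr rfl fun i _ => ?_
  rw [intervalIntegral.integral_finsetSum fun j _ => (hc i j).intervalIntegrable _ _]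
  refine Finset.sum_congr rfl fun j _ => ?_
  rw [intervalIntegral.integral_const_mul, intervalIntegral.integral_mul_const]

/-- A null vector would give a polynomial of zero `L²(0,1)` norm, which vanishes on all of `[0,1]`
and so has zero coefficients. -/
theorem isUnit_det_gramMatrix_pow (r : ℕ) :
    IsUnit (gramMatrix fun (i : Fin r) τ => τ ^ (i : ℕ)).det := by
  rw [← Matrix.isUnit_iff_isUnit_det, ← Matrix.mulVec_injective_iff_isUnit]
  refine (injective_iff_map_eq_zero (Matrix.mulVecLin _)).2 fun c hc => ?_
  have hcont : ∀ i : Fin r, Continuous fun τ : ℝ => τ ^ (i : ℕ) := fun i => by fun_prop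
  have h0 := dotProduct_gramMatrix_mulVec hcont c
  rw [show gramMatrix (fun (i : Fin r) τ => τ ^ (i : ℕ)) *ᵥ c = 0 from hc, dotProduct_zero] at h0
  let p : Polynomial ℝ := ∑ i : Fin r, Polynomial.C (c i) * Polynomial.X ^ (i : ℕ)
  have hp : ∀ τ, p.eval τ = ∑ i, c i * τ ^ (i : ℕ) := fun τ => by
    simp [p, Polynomial.eval_finsetSum]
  have hroot : ∀ τ ∈ Set.Icc (0 : ℝ) 1, p.IsRoot τ := fun τ hτ => by
    by_contra hne
    have hpos : 0 < ∫ τ in (0 : ℝ)..1, (∑ i, c i * τ ^ (i : ℕ)) ^ 2 := by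
      refine intervalIntegral.integral_pos one_pos (by fun_prop) (fun _ _ => sq_nonneg _)
        ⟨τ, hτ, ?_⟩
      rw [← hp]
      exact (sq_nonneg _).lt_of_ne' (pow_ne_zero 2 hne)
    exact hpos.ne h0
  have hp0 : p = 0 := Polynomial.eq_zero_of_infinite_isRoot p
    ((Set.Icc_infinite one_pos).mono hroot)
  funext i
  have hcoef := congrArg (fun q => Polynomial.coeff q i) hp0
  simpa [p, Polynomial.finsetSum_coeff, Polynomial.coeff_C_mul, Polynomial.coeff_X_pow,
    Fin.val_inj] using hcoef

theorem tendsto_matrix_inv {r : ℕ} {α : Type*} {l : Filter α}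
    {G : α → Matrix (Fin r) (Fin r) ℝ} {G₀ : Matrix (Fin r) (Fin r) ℝ}
    (hG : Filter.Tendsto G l (nhds G₀)) (hu : IsUnit G₀.det) :
    Filter.Tendsto (fun a => (G a)⁻¹) l (nhds G₀⁻¹) := by
  simp only [Matrix.inv_def]
  refine Filter.Tendsto.smul ?_ ((continuous_id.matrix_adjugate.tendsto G₀).comp hG)
  simp only [Ring.inverse_eq_inv']
  exact ((continuous_id.matrix_det.tendsto G₀).comp hG).inv₀ hu.ne_zero

/-- The kernel does not depend on the basis used to write it. -/
theorem kernelP_eq_of_basis {r : ℕ} {φ : Fin r → ℝ → ℝ} (hφ : ∀ i, Continuous (φ i)) {t₀ h : ℝ}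
    {S : Matrix (Fin r) (Fin r) ℝ} (hS : IsUnit S.det) (τ σ : ℝ) :
    kernelP φ t₀ h τ σ = (S *ᵥ fun i => φ i (t₀ + τ * h)) ⬝ᵥ
      ((gramMatrix fun k τ => (S *ᵥ fun i => φ i (t₀ + τ * h)) k)⁻¹ *ᵥ
        (S *ᵥ fun i => φ i (t₀ + σ * h))) := by
  have hST : IsUnit Sᵀ.det := by rwa [Matrix.det_transpose]
  rw [gramMatrix_mulVec (e := fun i τ => φ i (t₀ + τ * h))
    (fun i => (hφ i).comp (by fun_prop)), ← gram_eq_gramMatrix, Matrix.mul_inv_rev,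
    Matrix.mul_inv_rev, Matrix.mulVec_mulVec, Matrix.dotProduct_mulVec]
  rw [← Matrix.vecMul_transpose, Matrix.vecMul_vecMul, ← Matrix.dotProduct_mulVec]
  have : Sᵀ * (Sᵀ⁻¹ * ((gram φ t₀ h)⁻¹ * S⁻¹) * S) = (gram φ t₀ h)⁻¹ := by
    rw [mul_assoc Sᵀ⁻¹, ← mul_assoc, Matrix.mul_nonsing_inv _ hST, one_mul, mul_assoc,
      Matrix.nonsing_inv_mul _ hS, mul_one]
  rw [this]
  rfl

theorem abs_gramMatrix_sub_le {r : ℕ} {e e' : Fin r → ℝ → ℝ} (he : ∀ i, Continuous (e i))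
    (he' : ∀ i, Continuous (e' i)) {ε B : ℝ}
    (hB : ∀ i, ∀ τ ∈ Set.Icc (0 : ℝ) 1, |e i τ| ≤ B)
    (hB' : ∀ i, ∀ τ ∈ Set.Icc (0 : ℝ) 1, |e' i τ| ≤ B)
    (hε : ∀ i, ∀ τ ∈ Set.Icc (0 : ℝ) 1, |e i τ - e' i τ| ≤ ε) (i j : Fin r) :
    |gramMatrix e i j - gramMatrix e' i j| ≤ 2 * B * ε := by
  simp only [gramMatrix, Matrix.of_apply]
  rw [← intervalIntegral.integral_sub
    (Continuous.intervalIntegrable (by have := he i; have := he j; fun_prop) _ _)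
    (Continuous.intervalIntegrable (by have := he' i; have := he' j; fun_prop) _ _),
    ← Real.norm_eq_abs]
  refine (intervalIntegral.norm_integral_le_of_norm_le_const (C := 2 * B * ε)
    fun τ hτ => ?_).trans (by simp)
  rw [Set.uIoc_of_le zero_le_one] at hτ
  have hτ' := Set.Ioc_subset_Icc_self hτ
  have hB0 : 0 ≤ B := (abs_nonneg _).trans (hB i τ hτ')
  calc ‖e i τ * e j τ - e' i τ * e' j τ‖
      = ‖e i τ * (e j τ - e' j τ) + (e i τ - e' i τ) * e' j τ‖ := by congr 1; ring
    _ ≤ ‖e i τ * (e j τ - e' j τ)‖ + ‖(e i τ - e' i τ) * e' j τ‖ := norm_add_le _ _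
    _ = |e i τ| * |e j τ - e' j τ| + |e i τ - e' i τ| * |e' j τ| := by
      simp only [Real.norm_eq_abs, abs_mul]
    _ ≤ B * ε + ε * B := by
      gcongr
      · exact hB i τ hτ'
      · exact hε j τ hτ'
      · exact (abs_nonneg _).trans (hε i τ hτ')
      · exact hε i τ hτ'
      · exact hB' j τ hτ'
    _ = 2 * B * ε := by ring

theorem abs_dotProduct_mulVec_le {r : ℕ} {a b : Fin r → ℝ} {A : Matrix (Fin r) (Fin r) ℝ}
    {B L : ℝ} (ha : ∀ i, |a i| ≤ B) (hb : ∀ i, |b i| ≤ B) (hA : ∀ i j, |A i j| ≤ L) :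
    |a ⬝ᵥ (A *ᵥ b)| ≤ r * (r * (B * (L * B))) := by
  simp only [dotProduct, Matrix.mulVec, Finset.mul_sum]
  refine (Finset.abs_sum_le_sum_abs _ _).trans ?_
  refine (Finset.sum_le_card_nsmul _ _ (r * (B * (L * B))) fun i _ => ?_).trans (by simp)
  refine (Finset.abs_sum_le_sum_abs _ _).trans ?_
  refine (Finset.sum_le_card_nsmul _ _ (B * (L * B)) fun j _ => ?_).trans (by simp)
  have hB : 0 ≤ B := (abs_nonneg _).trans (ha i)
  have hL : 0 ≤ L := (abs_nonneg _).trans (hA i i)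
  rw [abs_mul, abs_mul]
  gcongr
  · exact ha i
  · exact hA i j
  · exact hb j

/-- In the basis `h^(-k) (S φ)_k` the functions are `τ^k + O(h)` on `[0,1]`, so their Gram matrix
tends to that of the monomials and its inverse stays bounded. Basis independence transfers the bound
to the kernel. -/
theorem exists_kernel_bound {r : ℕ} {φ : Fin r → ℝ → ℝ} (hφ : ∀ i, Continuous (φ i)) {t₀ : ℝ}
    {S : Matrix (Fin r) (Fin r) ℝ} (hS : IsUnit S.det) {C : ℝ} (hC : 0 ≤ C)
    (hSC : ∀ k, ∀ t ∈ Set.Icc t₀ (t₀ + 1),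
      |(S *ᵥ fun i => φ i t) k - (t - t₀) ^ (k : ℕ)| ≤ C * (t - t₀) ^ r) :
    ∃ K, 0 ≤ K ∧ ∀ᶠ h in nhdsWithin (0 : ℝ) (Set.Ioi 0), IsUnit (gram φ t₀ h).det ∧
      ∀ τ ∈ Set.Icc (0 : ℝ) 1, ∀ σ ∈ Set.Icc (0 : ℝ) 1, |kernelP φ t₀ h τ σ| ≤ K := by
  let Sc : ℝ → Matrix (Fin r) (Fin r) ℝ := fun h =>
    Matrix.diagonal (fun k : Fin r => (h ^ (k : ℕ))⁻¹) * S
  let e : ℝ → Fin r → ℝ → ℝ := fun h k τ => (Sc h *ᵥ fun i => φ i (t₀ + τ * h)) k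
  let m : Fin r → ℝ → ℝ := fun k τ => τ ^ (k : ℕ)
  have hScdet : ∀ h : ℝ, 0 < h → IsUnit (Sc h).det := fun h hh => by
    rw [Matrix.det_mul, Matrix.det_diagonal]
    refine IsUnit.mul (isUnit_iff_ne_zero.2 (Finset.prod_ne_zero_iff.2 fun k _ => ?_)) hS
    positivity
  have hecont : ∀ h k, Continuous (e h k) := fun h k => by
    simp only [e, Matrix.mulVec, dotProduct]
    refine continuous_finsetSum _ fun i _ => continuous_const.mul ((hφ i).comp (by fun_prop))
  have hmcont : ∀ k, Continuous (m k) := fun k => by fun_prop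
  have hclose : ∀ h : ℝ, 0 < h → h ≤ 1 → ∀ k, ∀ τ ∈ Set.Icc (0 : ℝ) 1,
      |e h k τ - m k τ| ≤ C * h := fun h hh hh1 k τ hτ => by
    have hmem : t₀ + τ * h ∈ Set.Icc t₀ (t₀ + 1) := by
      have := mul_nonneg hτ.1 hh.le
      have := mul_le_one₀ hτ.2 hh.le hh1
      constructor <;> linarith
    have h1 := hSC k _ hmem
    have hek : e h k τ = (h ^ (k : ℕ))⁻¹ * (S *ᵥ fun i => φ i (t₀ + τ * h)) k := by
      simp only [e, Sc, ← Matrix.mulVec_mulVec, Matrix.mulVec_diagonal]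
    have hpk : 0 < h ^ (k : ℕ) := pow_pos hh _
    have hem : e h k τ - m k τ =
        (h ^ (k : ℕ))⁻¹ * ((S *ᵥ fun i => φ i (t₀ + τ * h)) k - (τ * h) ^ (k : ℕ)) := by
      rw [hek, mul_pow]
      simp only [m]
      field_simp
    rw [add_sub_cancel_left] at h1
    rw [hem, abs_mul, abs_of_pos (inv_pos.2 hpk), inv_mul_le_iff₀ hpk]
    refine h1.trans ?_
    calc C * (τ * h) ^ r ≤ C * h ^ r := by
          have := mul_nonneg hτ.1 hh.le
          gcongr
          exact mul_le_of_le_one_left hh.le hτ.2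
      -- Since `k < r`, division by `h ^ k` still leaves one power of `h`.
      _ ≤ C * h ^ ((k : ℕ) + 1) := by
          gcongr C * ?_
          exact pow_le_pow_of_le_one hh.le hh1 k.2
      _ = h ^ (k : ℕ) * (C * h) := by ring
  have hmB : ∀ k, ∀ τ ∈ Set.Icc (0 : ℝ) 1, |m k τ| ≤ 1 + C := fun k τ hτ => by
    rw [abs_of_nonneg (pow_nonneg hτ.1 _)]
    exact (pow_le_one₀ hτ.1 hτ.2).trans (by linarith)
  have heB : ∀ h : ℝ, 0 < h → h ≤ 1 → ∀ k, ∀ τ ∈ Set.Icc (0 : ℝ) 1, |e h k τ| ≤ 1 + C :=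
    fun h hh hh1 k τ hτ => by
    have h1 := hclose h hh hh1 k τ hτ
    have h2 : |m k τ| ≤ 1 := by
      rw [abs_of_nonneg (pow_nonneg hτ.1 _)]
      exact pow_le_one₀ hτ.1 hτ.2
    have h3 := abs_add_le (e h k τ - m k τ) (m k τ)
    rw [sub_add_cancel] at h3
    have := mul_le_of_le_one_right hC hh1
    linarith
  have hev : ∀ᶠ h in nhdsWithin (0 : ℝ) (Set.Ioi 0), 0 < h ∧ h ≤ 1 := by
    filter_upwards [Ioc_mem_nhdsGT one_pos] with h hh using hh
  have hG : Filter.Tendsto (fun h => gramMatrix (e h)) (nhdsWithin 0 (Set.Ioi 0))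
      (nhds (gramMatrix m)) := by
    refine tendsto_pi_nhds.2 fun i => tendsto_pi_nhds.2 fun j => ?_
    rw [tendsto_iff_norm_sub_tendsto_zero]
    have hz : Filter.Tendsto (fun h : ℝ => 2 * (1 + C) * (C * h)) (nhdsWithin 0 (Set.Ioi 0))
        (nhds 0) := by
      refine Filter.Tendsto.mono_left ?_ nhdsWithin_le_nhds
      have : Continuous fun h : ℝ => 2 * (1 + C) * (C * h) := by fun_prop
      simpa using this.tendsto 0
    refine squeeze_zero' (Filter.Eventually.of_forall fun _ => norm_nonneg _) ?_ hz
    filter_upwards [hev] with h hh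
    exact abs_gramMatrix_sub_le (hecont h) hmcont (heB h hh.1 hh.2) hmB (hclose h hh.1 hh.2) i j
  have hGinv := tendsto_matrix_inv hG (isUnit_det_gramMatrix_pow r)
  have hdet : ∀ᶠ h in nhdsWithin (0 : ℝ) (Set.Ioi 0), (gramMatrix (e h)).det ≠ 0 :=
    ((continuous_id.matrix_det.tendsto _).comp hG).eventually_ne
      (isUnit_det_gramMatrix_pow r).ne_zero
  -- One bound for all entries: each is eventually within 1 of its limit in absolute value, and the
  -- sum dominates every such bound.
  let L : ℝ := ∑ i, ∑ j, (|(gramMatrix m)⁻¹ i j| + 1)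
  have hinv : ∀ᶠ h in nhdsWithin (0 : ℝ) (Set.Ioi 0), ∀ i j, |(gramMatrix (e h))⁻¹ i j| ≤ L := by
    refine Filter.eventually_all.2 fun i => Filter.eventually_all.2 fun j => ?_
    have hij := (tendsto_pi_nhds.1 (tendsto_pi_nhds.1 hGinv i) j).abs
    filter_upwards [hij.eventually_lt_const (lt_add_one _)] with h hh
    refine hh.le.trans ?_
    refine le_trans ?_ (Finset.single_le_sum
      (f := fun i => ∑ j, (|(gramMatrix m)⁻¹ i j| + 1)) (fun i _ => by positivity)
      (Finset.mem_univ i))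
    exact Finset.single_le_sum (f := fun j => |(gramMatrix m)⁻¹ i j| + 1)
      (fun j _ => by positivity) (Finset.mem_univ j)
  have hL : 0 ≤ L := by positivity
  refine ⟨r * (r * ((1 + C) * (L * (1 + C)))), by positivity, ?_⟩
  filter_upwards [hev, hdet, hinv] with h hh hd hi
  constructor
  · have hGe : gramMatrix (e h) = Sc h * gram φ t₀ h * (Sc h)ᵀ :=
      gramMatrix_mulVec (e := fun i τ => φ i (t₀ + τ * h))
        (fun i => (hφ i).comp (by fun_prop)) (Sc h)
    rw [hGe, Matrix.det_mul, Matrix.det_mul] at hd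
    exact isUnit_iff_ne_zero.2 (right_ne_zero_of_mul (left_ne_zero_of_mul hd))
  · intro τ hτ σ hσ
    rw [kernelP_eq_of_basis hφ (hScdet h hh.1)]
    exact abs_dotProduct_mulVec_le (fun k => heB h hh.1 hh.2 k τ hτ)
      (fun k => heB h hh.1 hh.2 k σ hσ) hi

/-! ### The projection onto the rescaled span -/

section Projection

variable {E : Type*} [NormedAddCommGroup E] [NormedSpace ℝ E]
variable {r : ℕ} {φ : Fin r → ℝ → ℝ} {t₀ h : ℝ}

/-- Coefficients of the `L²(0,1)`-projection of `g` onto the span of `τ ↦ φ i (t₀ + τ h)`. -/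
noncomputable def projCoeff (φ : Fin r → ℝ → ℝ) (t₀ h : ℝ) (g : ℝ → E) (i : Fin r) : E :=
  ∑ j, (gram φ t₀ h)⁻¹ i j • ∫ σ in (0 : ℝ)..1, φ j (t₀ + σ * h) • g σ

/-- The `L²(0,1)`-projection of `g` onto the span of `τ ↦ φ i (t₀ + τ h)`. -/
noncomputable def proj (φ : Fin r → ℝ → ℝ) (t₀ h : ℝ) (g : ℝ → E) (τ : ℝ) : E :=
  ∑ i, φ i (t₀ + τ * h) • projCoeff φ t₀ h g i

theorem continuous_comp_affine (hφ : ∀ i, Continuous (φ i)) (i : Fin r) :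
    Continuous fun τ => φ i (t₀ + τ * h) := (hφ i).comp (by fun_prop)

theorem continuous_proj (hφ : ∀ i, Continuous (φ i)) (g : ℝ → E) :
    Continuous (proj φ t₀ h g) :=
  continuous_finsetSum _ fun i _ => (continuous_comp_affine hφ i).smul continuous_const

theorem intervalIntegrable_smul_of_continuousOn {a : ℝ → ℝ} (ha : Continuous a) {g : ℝ → E}
    (hg : ContinuousOn g (Set.Icc 0 1)) :
    IntervalIntegrable (fun σ => a σ • g σ) MeasureTheory.volume 0 1 :=
  (ha.continuousOn.smul hg).intervalIntegrable_of_Icc zero_le_one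

/-- Used with `a i = φ i (t₀ + τ * h)` to obtain the kernel `kernelP`, and with `a i` the integral
of this from `0` to `τ` to obtain `coeffA`. -/
theorem integral_sum_smul (hφ : ∀ i, Continuous (φ i)) {g : ℝ → E}
    (hg : ContinuousOn g (Set.Icc 0 1)) (a : Fin r → ℝ) :
    ∫ σ in (0 : ℝ)..1, (a ⬝ᵥ ((gram φ t₀ h)⁻¹ *ᵥ fun j => φ j (t₀ + σ * h))) • g σ =
      ∑ i, a i • projCoeff φ t₀ h g i := by
  simp only [projCoeff, dotProduct, Matrix.mulVec, Finset.smul_sum, Finset.sum_smul,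
    Finset.mul_sum]
  have hint : ∀ i j, IntervalIntegrable
      (fun σ => (a i * ((gram φ t₀ h)⁻¹ i j * φ j (t₀ + σ * h))) • g σ)
      MeasureTheory.volume 0 1 := fun i j => by
    have := continuous_comp_affine (t₀ := t₀) (h := h) hφ j
    exact intervalIntegrable_smul_of_continuousOn (by fun_prop) hg
  rw [intervalIntegral.integral_finsetSum fun i _ => ?_]
  · refine Finset.sum_congr rfl fun i _ => ?_
    rw [intervalIntegral.integral_finsetSum fun j _ => hint i j]
    refine Finset.sum_congr rfl fun j _ => ?_
    simp only [mul_smul]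
    rw [intervalIntegral.integral_smul, intervalIntegral.integral_smul]
  · have := IntervalIntegrable.sum (Finset.univ : Finset (Fin r)) fun j _ => hint i j
    simpa [Finset.sum_fn] using this

theorem proj_eq_integral_kernelP (hφ : ∀ i, Continuous (φ i)) {g : ℝ → E}
    (hg : ContinuousOn g (Set.Icc 0 1)) (τ : ℝ) :
    proj φ t₀ h g τ = ∫ σ in (0 : ℝ)..1, kernelP φ t₀ h τ σ • g σ :=
  (integral_sum_smul hφ hg _).symm

theorem integral_proj [CompleteSpace E] (hφ : ∀ i, Continuous (φ i)) (g : ℝ → E) (τ : ℝ) :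
    ∫ α in (0 : ℝ)..τ, proj φ t₀ h g α =
      ∑ i, (∫ α in (0 : ℝ)..τ, φ i (t₀ + α * h)) • projCoeff φ t₀ h g i := by
  simp only [proj]
  rw [intervalIntegral.integral_finsetSum fun i _ => Continuous.intervalIntegrable
    (by have := continuous_comp_affine (t₀ := t₀) (h := h) hφ i; fun_prop) _ _]
  exact Finset.sum_congr rfl fun i _ => intervalIntegral.integral_smul_const _ _

theorem integral_proj_eq_integral_coeffA [CompleteSpace E] (hφ : ∀ i, Continuous (φ i)) {g : ℝ → E}
    (hg : ContinuousOn g (Set.Icc 0 1)) (τ : ℝ) :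
    ∫ α in (0 : ℝ)..τ, proj φ t₀ h g α = ∫ σ in (0 : ℝ)..1, coeffA φ t₀ h τ σ • g σ := by
  rw [integral_proj hφ, ← integral_sum_smul hφ hg]
  refine intervalIntegral.integral_congr fun σ _ => ?_
  simp only [coeffA, kernelP, dotProduct]
  rw [intervalIntegral.integral_finsetSum fun i _ => Continuous.intervalIntegrable
    (by have := continuous_comp_affine (t₀ := t₀) (h := h) hφ i; fun_prop) _ _]
  simp only [intervalIntegral.integral_mul_const]

theorem norm_proj_le (hφ : ∀ i, Continuous (φ i)) {g : ℝ → E}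
    (hg : ContinuousOn g (Set.Icc 0 1)) {K B : ℝ}
    (hK : ∀ τ ∈ Set.Icc (0 : ℝ) 1, ∀ σ ∈ Set.Icc (0 : ℝ) 1, |kernelP φ t₀ h τ σ| ≤ K)
    (hB : ∀ σ ∈ Set.Icc (0 : ℝ) 1, ‖g σ‖ ≤ B) {τ : ℝ} (hτ : τ ∈ Set.Icc (0 : ℝ) 1) :
    ‖proj φ t₀ h g τ‖ ≤ K * B := by
  rw [proj_eq_integral_kernelP hφ hg]
  refine (intervalIntegral.norm_integral_le_of_norm_le_const (C := K * B)
    fun σ hσ => ?_).trans (by simp)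
  rw [Set.uIoc_of_le zero_le_one] at hσ
  have hσ' := Set.Ioc_subset_Icc_self hσ
  have hK' := hK τ hτ σ hσ'
  rw [norm_smul, Real.norm_eq_abs]
  exact mul_le_mul hK' (hB σ hσ') (norm_nonneg _) ((abs_nonneg _).trans hK')

theorem projCoeff_congr {g g' : ℝ → E} (hgg : Set.EqOn g g' (Set.Icc 0 1)) :
    projCoeff φ t₀ h g = projCoeff φ t₀ h g' := by
  funext i
  refine Finset.sum_congr rfl fun j _ => ?_
  congr 1
  refine intervalIntegral.integral_congr fun σ hσ => ?_
  rw [Set.uIcc_of_le zero_le_one] at hσ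
  simp only [hgg hσ]

theorem proj_congr {g g' : ℝ → E} (hgg : Set.EqOn g g' (Set.Icc 0 1)) :
    proj φ t₀ h g = proj φ t₀ h g' := by
  funext τ
  simp only [proj, projCoeff_congr hgg]

theorem proj_sub (hφ : ∀ i, Continuous (φ i)) {g g' : ℝ → E}
    (hg : ContinuousOn g (Set.Icc 0 1)) (hg' : ContinuousOn g' (Set.Icc 0 1)) (τ : ℝ) :
    proj φ t₀ h (fun σ => g σ - g' σ) τ = proj φ t₀ h g τ - proj φ t₀ h g' τ := by
  simp only [proj, projCoeff, ← Finset.sum_sub_distrib, ← smul_sub]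
  refine Finset.sum_congr rfl fun i _ => ?_
  congr 1
  refine Finset.sum_congr rfl fun j _ => ?_
  rw [← intervalIntegral.integral_sub
    (intervalIntegrable_smul_of_continuousOn (continuous_comp_affine hφ j) hg)
    (intervalIntegrable_smul_of_continuousOn (continuous_comp_affine hφ j) hg')]
  simp only [smul_sub]

theorem integral_smul_sum_smul [CompleteSpace E] (hφ : ∀ i, Continuous (φ i)) (c : Fin r → E)
    (k : Fin r) :
    ∫ σ in (0 : ℝ)..1, φ k (t₀ + σ * h) • ∑ i, φ i (t₀ + σ * h) • c i =
      ∑ i, gram φ t₀ h k i • c i := by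
  simp only [Finset.smul_sum, smul_smul]
  rw [intervalIntegral.integral_finsetSum fun i _ => Continuous.intervalIntegrable
    (by
      have := continuous_comp_affine (t₀ := t₀) (h := h) hφ i
      have := continuous_comp_affine (t₀ := t₀) (h := h) hφ k
      fun_prop) _ _]
  exact Finset.sum_congr rfl fun i _ => intervalIntegral.integral_smul_const _ _

theorem sum_smul_sum_smul (A B : Matrix (Fin r) (Fin r) ℝ) (c : Fin r → E) (k : Fin r) :
    ∑ i, A k i • ∑ j, B i j • c j = ∑ j, (A * B) k j • c j := by
  simp only [Finset.smul_sum, smul_smul, Matrix.mul_apply, Finset.sum_smul]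
  exact Finset.sum_comm

theorem sum_one_smul (c : Fin r → E) (k : Fin r) :
    ∑ j, (1 : Matrix (Fin r) (Fin r) ℝ) k j • c j = c k := by
  simp [Matrix.one_apply]

theorem projCoeff_sum_smul [CompleteSpace E] (hφ : ∀ i, Continuous (φ i))
    (hu : IsUnit (gram φ t₀ h).det) (c : Fin r → E) :
    projCoeff φ t₀ h (fun σ => ∑ i, φ i (t₀ + σ * h) • c i) = c := by
  funext k
  simp only [projCoeff, integral_smul_sum_smul hφ]
  rw [sum_smul_sum_smul, Matrix.nonsing_inv_mul _ hu, sum_one_smul]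

theorem proj_sum_smul [CompleteSpace E] (hφ : ∀ i, Continuous (φ i))
    (hu : IsUnit (gram φ t₀ h).det) (c : Fin r → E) (τ : ℝ) :
    proj φ t₀ h (fun σ => ∑ i, φ i (t₀ + σ * h) • c i) τ = ∑ i, φ i (t₀ + τ * h) • c i := by
  simp only [proj, projCoeff_sum_smul hφ hu]

theorem integral_smul_proj [CompleteSpace E] (hφ : ∀ i, Continuous (φ i))
    (hu : IsUnit (gram φ t₀ h).det) (g : ℝ → E) (k : Fin r) :
    ∫ σ in (0 : ℝ)..1, φ k (t₀ + σ * h) • proj φ t₀ h g σ =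
      ∫ σ in (0 : ℝ)..1, φ k (t₀ + σ * h) • g σ := by
  simp only [proj, integral_smul_sum_smul hφ, projCoeff]
  rw [sum_smul_sum_smul, Matrix.mul_nonsing_inv _ hu, sum_one_smul]

/-- For `w` in the span, `P g - g = P (g - w) - (g - w)`: a bounded projection is quasi-optimal. -/
theorem norm_proj_sub_self_le [CompleteSpace E] (hφ : ∀ i, Continuous (φ i))
    (hu : IsUnit (gram φ t₀ h).det) {g : ℝ → E}
    (hg : ContinuousOn g (Set.Icc 0 1)) {K B : ℝ}
    (hK : ∀ τ ∈ Set.Icc (0 : ℝ) 1, ∀ σ ∈ Set.Icc (0 : ℝ) 1, |kernelP φ t₀ h τ σ| ≤ K)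
    (c : Fin r → E)
    (hB : ∀ σ ∈ Set.Icc (0 : ℝ) 1, ‖g σ - ∑ i, φ i (t₀ + σ * h) • c i‖ ≤ B) {τ : ℝ}
    (hτ : τ ∈ Set.Icc (0 : ℝ) 1) :
    ‖proj φ t₀ h g τ - g τ‖ ≤ (K + 1) * B := by
  have hw : Continuous fun σ => ∑ i, φ i (t₀ + σ * h) • c i :=
    continuous_finsetSum _ fun i _ => (continuous_comp_affine hφ i).smul continuous_const
  have h1 := norm_proj_le (g := fun σ => g σ - ∑ i, φ i (t₀ + σ * h) • c i) hφ
    (hg.sub hw.continuousOn) hK hB hτ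
  rw [proj_sub hφ hg hw.continuousOn, proj_sum_smul hφ hu] at h1
  calc ‖proj φ t₀ h g τ - g τ‖
      = ‖(proj φ t₀ h g τ - ∑ i, φ i (t₀ + τ * h) • c i)
          - (g τ - ∑ i, φ i (t₀ + τ * h) • c i)‖ := by congr 1; abel
    _ ≤ K * B + B := (norm_sub_le _ _).trans (add_le_add h1 (hB τ hτ))
    _ = (K + 1) * B := by ring

/-- Functions of class `C^r` are approximated to order `r` by the span of the `φ i`. -/
theorem exists_approx [CompleteSpace E] {S : Matrix (Fin r) (Fin r) ℝ}
    {C : ℝ} (hC : 0 ≤ C) {T : ℝ} (hT : t₀ < T)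
    (hSC : ∀ k, ∀ t ∈ Set.Icc t₀ (t₀ + 1),
      |(S *ᵥ fun i => φ i t) k - (t - t₀) ^ (k : ℕ)| ≤ C * (t - t₀) ^ r)
    {g : ℝ → E} (hg : ContDiffOn ℝ r g (Set.Icc t₀ T)) :
    ∃ (c : Fin r → E) (B : ℝ), 0 ≤ B ∧ ∀ t ∈ Set.Icc t₀ T, t ≤ t₀ + 1 →
      ‖g t - ∑ i, φ i t • c i‖ ≤ B * (t - t₀) ^ r := by
  obtain ⟨B, hB0, hB⟩ := exists_taylor_bound hT.le hg
  set a : Fin r → E := fun k => ((k : ℕ).factorial : ℝ)⁻¹ •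
    iteratedDerivWithin k g (Set.Icc t₀ T) t₀
  -- The Taylor coefficients `a k` of `g` are placed on the functions `(S φ)_k`, then re-expanded in
  -- the `φ i`.
  refine ⟨fun i => ∑ k, S k i • a k, B + ∑ k, C * ‖a k‖, by positivity, fun t ht ht1 => ?_⟩
  have hsum : ∑ i, φ i t • ∑ k, S k i • a k = ∑ k, (S *ᵥ fun i => φ i t) k • a k := by
    simp only [Finset.smul_sum, smul_smul, Matrix.mulVec, dotProduct, Finset.sum_smul]
    rw [Finset.sum_comm]
    simp only [mul_comm]
  have hsplit : g t - ∑ k, (S *ᵥ fun i => φ i t) k • a k =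
      (g t - ∑ k : Fin r, (t - t₀) ^ (k : ℕ) • a k)
        - ∑ k, ((S *ᵥ fun i => φ i t) k - (t - t₀) ^ (k : ℕ)) • a k := by
    simp only [sub_smul, Finset.sum_sub_distrib]
    abel
  rw [hsum, hsplit, add_mul, Finset.sum_mul]
  refine (norm_sub_le _ _).trans (add_le_add (hB t ht) ((norm_sum_le _ _).trans
    (Finset.sum_le_sum fun k _ => ?_)))
  rw [norm_smul, Real.norm_eq_abs]
  calc _ ≤ C * (t - t₀) ^ r * ‖a k‖ := by gcongr; exact hSC k t ⟨ht.1, ht1⟩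
    _ = _ := by ring

end Projection

/-! ### Existence and uniqueness in the projected integral form -/

section FixedPoint

variable {E : Type*} [NormedAddCommGroup E] [NormedSpace ℝ E]
variable {r : ℕ} {φ : Fin r → ℝ → ℝ} {t₀ h : ℝ}

theorem norm_integral_proj_sub_le (hφ : ∀ i, Continuous (φ i)) {g g' : ℝ → E}
    (hg : ContinuousOn g (Set.Icc 0 1)) (hg' : ContinuousOn g' (Set.Icc 0 1)) {K B : ℝ}
    (hK : ∀ τ ∈ Set.Icc (0 : ℝ) 1, ∀ σ ∈ Set.Icc (0 : ℝ) 1, |kernelP φ t₀ h τ σ| ≤ K)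
    (hB : ∀ σ ∈ Set.Icc (0 : ℝ) 1, ‖g σ - g' σ‖ ≤ B) {τ : ℝ} (hτ : τ ∈ Set.Icc (0 : ℝ) 1) :
    ‖(∫ α in (0 : ℝ)..τ, proj φ t₀ h g α) - ∫ α in (0 : ℝ)..τ, proj φ t₀ h g' α‖ ≤ K * B := by
  rw [← intervalIntegral.integral_sub ((continuous_proj hφ g).intervalIntegrable _ _)
    ((continuous_proj hφ g').intervalIntegrable _ _)]
  have h0 : (0 : ℝ) ∈ Set.Icc (0 : ℝ) 1 := ⟨le_rfl, zero_le_one⟩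
  have hKB : 0 ≤ K * B := mul_nonneg ((abs_nonneg _).trans (hK 0 h0 0 h0))
    ((norm_nonneg _).trans (hB 0 h0))
  refine (intervalIntegral.norm_integral_le_of_norm_le_const (C := K * B) fun α hα => ?_).trans ?_
  · rw [Set.uIoc_of_le hτ.1] at hα
    rw [← proj_sub hφ hg hg']
    exact norm_proj_le hφ (hg.sub hg') hK hB ⟨hα.1.le, hα.2.trans hτ.2⟩
  · rw [sub_zero, abs_of_nonneg hτ.1]
    exact mul_le_of_le_one_right hKB hτ.2

theorem norm_integral_proj_le (hφ : ∀ i, Continuous (φ i)) {g : ℝ → E}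
    (hg : ContinuousOn g (Set.Icc 0 1)) {K B : ℝ}
    (hK : ∀ τ ∈ Set.Icc (0 : ℝ) 1, ∀ σ ∈ Set.Icc (0 : ℝ) 1, |kernelP φ t₀ h τ σ| ≤ K)
    (hB : ∀ σ ∈ Set.Icc (0 : ℝ) 1, ‖g σ‖ ≤ B) {τ : ℝ} (hτ : τ ∈ Set.Icc (0 : ℝ) 1) :
    ‖∫ α in (0 : ℝ)..τ, proj φ t₀ h g α‖ ≤ K * B := by
  have := norm_integral_proj_sub_le (g' := fun _ => 0) hφ hg continuousOn_const hK
    (by simpa using hB) hτ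
  simpa [proj, projCoeff] using this

variable {f : E → E} {y₀ : E} {s : Set E} {K L M R : ℝ}

/-- Banach's fixed point theorem on continuous maps from `[0,1]` into the ball: `hhM` gives the
self-map, `hhL` the contraction. -/
theorem exists_proj_solution [CompleteSpace E] (hφ : ∀ i, Continuous (φ i))
    (hK : ∀ τ ∈ Set.Icc (0 : ℝ) 1, ∀ σ ∈ Set.Icc (0 : ℝ) 1, |kernelP φ t₀ h τ σ| ≤ K)
    (hR : 0 ≤ R) (hfc : ContinuousOn f (Metric.closedBall y₀ R))
    (hL : ∀ x ∈ Metric.closedBall y₀ R, ∀ x' ∈ Metric.closedBall y₀ R,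
      ‖f x - f x'‖ ≤ L * ‖x - x'‖) (hL0 : 0 ≤ L)
    (hM : ∀ x ∈ Metric.closedBall y₀ R, ‖f x‖ ≤ M) (hh : 0 ≤ h)
    (hhM : h * (K * M) ≤ R) (hhL : h * (K * L) < 1) :
    ∃ u : ℝ → E, (∀ τ ∈ Set.Icc (0 : ℝ) 1, u τ ∈ Metric.closedBall y₀ R) ∧
      ∀ τ, u τ = y₀ + h • ∫ α in (0 : ℝ)..τ, proj φ t₀ h (fun σ => f (u σ)) α := by
  have h0 : (0 : ℝ) ∈ Set.Icc (0 : ℝ) 1 := ⟨le_rfl, zero_le_one⟩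
  have hK0 : 0 ≤ K := (abs_nonneg _).trans (hK 0 h0 0 h0)
  let ext : C(Set.Icc (0 : ℝ) 1, E) → ℝ → E := fun w => Set.IccExtend zero_le_one w
  have hext : ∀ w, Continuous (ext w) := fun w => w.continuous.Icc_extend'
  let F : (ℝ → E) → ℝ → E := fun w τ =>
    y₀ + h • ∫ α in (0 : ℝ)..τ, proj φ t₀ h (fun σ => f (w σ)) α
  have hF : ∀ w, Continuous (F w) := fun w => continuous_const.add
    ((intervalIntegral.continuous_primitive
      (fun a b => (continuous_proj hφ _).intervalIntegrable a b) 0).const_smul h)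
  let Φ : C(Set.Icc (0 : ℝ) 1, E) → C(Set.Icc (0 : ℝ) 1, E) := fun w =>
    ⟨fun τ => F (ext w) τ, (hF (ext w)).comp continuous_subtype_val⟩
  let s : Set C(Set.Icc (0 : ℝ) 1, E) := {w | ∀ τ, w τ ∈ Metric.closedBall y₀ R}
  have hs : IsClosed s := by
    have : s = ⋂ τ, (fun w : C(Set.Icc (0 : ℝ) 1, E) => w τ) ⁻¹' Metric.closedBall y₀ R := by
      ext w
      simp [s]
    rw [this]
    exact isClosed_iInter fun τ =>
      Metric.isClosed_closedBall.preimage (continuous_eval_const τ)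
  have hexts : ∀ w ∈ s, ∀ τ, ext w τ ∈ Metric.closedBall y₀ R := fun w hw τ => hw _
  have hfext : ∀ w ∈ s, ContinuousOn (fun σ => f (ext w σ)) (Set.Icc 0 1) := fun w hw =>
    hfc.comp (hext w).continuousOn fun τ _ => hexts w hw τ
  have hmaps : Set.MapsTo Φ s s := fun w hw τ => by
    have h1 := norm_integral_proj_le hφ (hfext w hw) hK (fun σ _ => hM _ (hexts w hw σ)) τ.2
    rw [mem_closedBall_iff_norm]
    change ‖y₀ + h • _ - y₀‖ ≤ R
    rw [add_sub_cancel_left, norm_smul, Real.norm_of_nonneg hh]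
    exact (mul_le_mul_of_nonneg_left h1 hh).trans hhM
  have hcontr : ContractingWith ⟨h * (K * L), by positivity⟩ (hmaps.restrict Φ s s) := by
    refine ⟨hhL, LipschitzWith.of_dist_le_mul fun w w' => ?_⟩
    change dist (Φ w) (Φ w') ≤ h * (K * L) * dist w.1 w'.1
    refine (ContinuousMap.dist_le (by positivity)).2 fun τ => ?_
    rw [dist_eq_norm]
    change ‖(y₀ + h • _) - (y₀ + h • _)‖ ≤ _
    rw [add_sub_add_left_eq_sub, ← smul_sub, norm_smul, Real.norm_of_nonneg hh, mul_assoc]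
    refine mul_le_mul_of_nonneg_left ?_ hh
    refine (norm_integral_proj_sub_le hφ (hfext w w.2) (hfext w' w'.2) hK
      (B := L * dist w.1 w'.1) (fun σ _ => ?_) τ.2).trans (by rw [mul_assoc])
    refine (hL _ (hexts w w.2 σ) _ (hexts w' w'.2 σ)).trans (mul_le_mul_of_nonneg_left ?_ hL0)
    rw [← dist_eq_norm]
    exact ContinuousMap.dist_apply_le_dist _
  obtain ⟨w, hw, hfix, -⟩ := hcontr.exists_fixedPoint' hs.isComplete hmaps
    (x := ContinuousMap.const _ y₀) (fun τ => Metric.mem_closedBall_self hR) (edist_ne_top _ _)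
  have hfixτ : ∀ τ ∈ Set.Icc (0 : ℝ) 1, F (ext w) τ = ext w τ := fun τ hτ => by
    have h1 := congrArg (fun v : C(Set.Icc (0 : ℝ) 1, E) => v ⟨τ, hτ⟩) hfix
    rw [show ext w τ = w ⟨τ, hτ⟩ from Set.IccExtend_of_mem _ _ hτ]
    exact h1
  -- `F (ext w)` agrees with `ext w` on `[0,1]`, the only place where the projection samples its
  -- argument, and it satisfies the equation at every real `τ`, as the variational form demands.
  refine ⟨F (ext w), fun τ hτ => ?_, fun τ => ?_⟩
  · rw [hfixτ τ hτ]
    exact hexts w hw τ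
  · change F (ext w) τ = F (F (ext w)) τ
    exact congrArg (fun p : ℝ → E => y₀ + h • ∫ α in (0 : ℝ)..τ, p α)
      (proj_congr fun σ hσ => congrArg f (hfixτ σ hσ).symm)

/-- At a maximum point the difference of two solutions is at most `h * (K * L) < 1` times itself. -/
theorem eqOn_of_proj_solution (hφ : ∀ i, Continuous (φ i))
    (hK : ∀ τ ∈ Set.Icc (0 : ℝ) 1, ∀ σ ∈ Set.Icc (0 : ℝ) 1, |kernelP φ t₀ h τ σ| ≤ K)
    (hfc : ContinuousOn f s) (hL : ∀ x ∈ s, ∀ x' ∈ s, ‖f x - f x'‖ ≤ L * ‖x - x'‖)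
    (hL0 : 0 ≤ L) (hh : 0 ≤ h) (hhL : h * (K * L) < 1) {u v : ℝ → E}
    (hu : ContinuousOn u (Set.Icc 0 1)) (hus : ∀ τ ∈ Set.Icc (0 : ℝ) 1, u τ ∈ s)
    (hue : ∀ τ ∈ Set.Icc (0 : ℝ) 1,
      u τ = y₀ + h • ∫ α in (0 : ℝ)..τ, proj φ t₀ h (fun σ => f (u σ)) α)
    (hv : ContinuousOn v (Set.Icc 0 1)) (hvs : ∀ τ ∈ Set.Icc (0 : ℝ) 1, v τ ∈ s)
    (hve : ∀ τ ∈ Set.Icc (0 : ℝ) 1,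
      v τ = y₀ + h • ∫ α in (0 : ℝ)..τ, proj φ t₀ h (fun σ => f (v σ)) α) :
    Set.EqOn u v (Set.Icc 0 1) := by
  obtain ⟨τ₁, hτ₁, hmax⟩ := isCompact_Icc.exists_isMaxOn (Set.nonempty_Icc.2 zero_le_one)
    (hu.sub hv).norm
  have hle : ∀ τ ∈ Set.Icc (0 : ℝ) 1, ‖u τ - v τ‖ ≤ ‖u τ₁ - v τ₁‖ := fun τ hτ => hmax hτ
  have h1 : ‖u τ₁ - v τ₁‖ ≤ h * (K * L) * ‖u τ₁ - v τ₁‖ := by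
    conv_lhs => rw [hue τ₁ hτ₁, hve τ₁ hτ₁]
    rw [add_sub_add_left_eq_sub, ← smul_sub, norm_smul, Real.norm_of_nonneg hh, mul_assoc,
      mul_assoc]
    exact mul_le_mul_of_nonneg_left (norm_integral_proj_sub_le hφ (hfc.comp hu hus)
      (hfc.comp hv hvs) hK (fun σ hσ => (hL _ (hus σ hσ) _ (hvs σ hσ)).trans
        (mul_le_mul_of_nonneg_left (hle σ hσ) hL0)) hτ₁) hh
  have h2 : ‖u τ₁ - v τ₁‖ = 0 := by
    have := norm_nonneg (u τ₁ - v τ₁)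
    nlinarith
  intro τ hτ
  have := hle τ hτ
  rw [h2] at this
  exact sub_eq_zero.1 (norm_le_zero_iff.1 this)

end FixedPoint

/-! ### The variational and the continuous-stage form -/

section Forms

variable {d₁ r : ℕ} {φ : Fin r → ℝ → ℝ} {f : Phase d₁ → Phase d₁} {t₀ h : ℝ} {y₀ : Phase d₁}

theorem isContinuousStageSolution_iff (hφ : ∀ i, Continuous (φ i)) (hf : Continuous f)
    {u : ℝ → Phase d₁} : IsContinuousStageSolution φ f t₀ h y₀ u ↔
      ContinuousOn u (Set.Icc 0 1) ∧ ∀ τ ∈ Set.Icc (0 : ℝ) 1,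
        u τ = y₀ + h • ∫ α in (0 : ℝ)..τ, proj φ t₀ h (fun σ => f (u σ)) α := by
  refine and_congr_right fun hu => forall₂_congr fun τ _ => ?_
  rw [integral_proj_eq_integral_coeffA (g := fun σ => f (u σ)) hφ (hf.comp_continuousOn hu)]

theorem pairing_sum_smul (hφ : ∀ i, Continuous (φ i)) (W : Fin r → Phase d₁)
    {g : ℝ → Phase d₁} (hg : ContinuousOn g (Set.Icc 0 1)) :
    pairing (fun τ => ∑ i, φ i (t₀ + τ * h) • W i) g = WithLp.toLp 2 fun j =>
      ∑ i, W i j * (∫ τ in (0 : ℝ)..1, φ i (t₀ + τ * h) • g τ) j := by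
  have hgj : ∀ j, ContinuousOn (fun τ => g τ j) (Set.Icc 0 1) := fun j =>
    (EuclideanSpace.proj (𝕜 := ℝ) j).continuous.comp_continuousOn hg
  have hint : ∀ i j, (∫ τ in (0 : ℝ)..1, φ i (t₀ + τ * h) • g τ) j =
      ∫ τ in (0 : ℝ)..1, φ i (t₀ + τ * h) * g τ j := fun i j =>
    ((EuclideanSpace.proj (𝕜 := ℝ) j).intervalIntegral_comp_comm
      (intervalIntegrable_smul_of_continuousOn (continuous_comp_affine hφ i) hg)).symm
  unfold pairing
  congr 1
  funext j
  simp only [hint]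
  have hsum : ∀ τ, (∑ i, φ i (t₀ + τ * h) • W i) j * g τ j =
      ∑ i, W i j * (φ i (t₀ + τ * h) * g τ j) := fun τ => by
    simp only [WithLp.ofLp_sum, WithLp.ofLp_smul, Finset.sum_apply, Pi.smul_apply, smul_eq_mul,
      Finset.sum_mul]
    exact Finset.sum_congr rfl fun i _ => by ring
  simp only [hsum]
  rw [intervalIntegral.integral_finsetSum fun i _ => ?_]
  · exact Finset.sum_congr rfl fun i _ => intervalIntegral.integral_const_mul _ _
  · exact ((intervalIntegrable_smul_of_continuousOn (continuous_comp_affine hφ i)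
      (hgj j))).const_mul (W i j)

theorem integral_eq_mul_integral_affine (a : ℝ → ℝ) (τ : ℝ) :
    ∫ s in t₀..(t₀ + τ * h), a s = h * ∫ α in (0 : ℝ)..τ, a (t₀ + α * h) := by
  have := intervalIntegral.mul_integral_comp_add_mul (a := 0) (b := τ) (f := a) h t₀
  simp only [zero_mul, add_zero, mul_comm h] at this
  rw [← this, mul_comm]

theorem mem_rescale_spaceX_iff {u : ℝ → Phase d₁} : u ∈ rescale (spaceX d₁ φ t₀) t₀ h ↔
    ∃ (V : Phase d₁) (W : Fin r → Phase d₁), ∀ τ,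
      u τ = V + h • ∑ i, (∫ α in (0 : ℝ)..τ, φ i (t₀ + α * h)) • W i := by
  have key : ∀ (V : Phase d₁) (W : Fin r → Phase d₁) (τ : ℝ),
      V + ∑ i, (∫ s in t₀..(t₀ + τ * h), φ i s) • W i =
        V + h • ∑ i, (∫ α in (0 : ℝ)..τ, φ i (t₀ + α * h)) • W i := fun V W τ => by
    simp only [integral_eq_mul_integral_affine, Finset.smul_sum, mul_smul]
  constructor
  · rintro ⟨w, ⟨V, W, hw⟩, hu⟩
    exact ⟨V, W, fun τ => by rw [hu, hw, key]⟩
  · rintro ⟨V, W, hu⟩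
    exact ⟨fun t => V + ∑ i, (∫ s in t₀..t, φ i s) • W i, ⟨V, W, fun t => rfl⟩,
      fun τ => (hu τ).trans (key V W τ).symm⟩

theorem hasDerivAt_of_eq_integral (hφ : ∀ i, Continuous (φ i)) {u : ℝ → Phase d₁}
    {V : Phase d₁} {W : Fin r → Phase d₁}
    (hu : ∀ τ, u τ = V + h • ∑ i, (∫ α in (0 : ℝ)..τ, φ i (t₀ + α * h)) • W i) (τ : ℝ) :
    HasDerivAt u (h • ∑ i, φ i (t₀ + τ * h) • W i) τ := by
  rw [funext hu]
  refine HasDerivAt.const_add _ (HasDerivAt.fun_const_smul _ (HasDerivAt.fun_sum fun i _ => ?_))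
  exact ((continuous_comp_affine hφ i).integral_hasStrictDerivAt 0 τ).hasDerivAt.smul_const _

/-- An element of `X_h` has derivative `h ∑ φ i • W i`. Testing against `Y_h` and cancelling `h`
gives the normal equations of the projection, so `W` must be the projection coefficients of `f ∘ u`.
-/
theorem isVariationalSolution_iff (hφ : ∀ i, Continuous (φ i)) (hf : Continuous f) (hh : h ≠ 0)
    (hM : IsUnit (gram φ t₀ h).det) {u : ℝ → Phase d₁} :
    IsVariationalSolution φ f t₀ h y₀ u ↔ Continuous u ∧ ∀ τ,
        u τ = y₀ + h • ∫ α in (0 : ℝ)..τ, proj φ t₀ h (fun σ => f (u σ)) α := by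
  have hpair : ∀ W : Fin r → Phase d₁, (∀ τ, HasDerivAt u (h • ∑ i, φ i (t₀ + τ * h) • W i) τ) →
      ((∀ v ∈ rescale (spaceY d₁ φ) t₀ h, pairing v (deriv u) = h • pairing v (f ∘ u)) ↔
        W = projCoeff φ t₀ h fun σ => f (u σ)) := by
    intro W hW
    have hu : Continuous u := continuous_iff_continuousAt.2 fun τ => (hW τ).continuousAt
    have hderiv : deriv u = fun τ => h • ∑ i, φ i (t₀ + τ * h) • W i :=
      funext fun τ => (hW τ).deriv
    have hderivc : Continuous (deriv u) := by
      rw [hderiv]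
      exact (continuous_finsetSum _ fun i _ =>
        (continuous_comp_affine hφ i).smul continuous_const).const_smul h
    have hint : ∀ i, ∫ τ in (0 : ℝ)..1, φ i (t₀ + τ * h) • deriv u τ =
        h • ∑ j, gram φ t₀ h i j • W j := fun i => by
      rw [← integral_smul_sum_smul hφ, ← intervalIntegral.integral_smul]
      simp only [hderiv, smul_comm h]
    have hv : ∀ W' : Fin r → Phase d₁,
        pairing (fun τ => ∑ i, φ i (t₀ + τ * h) • W' i) (deriv u) =
          h • pairing (fun τ => ∑ i, φ i (t₀ + τ * h) • W' i) (f ∘ u) ↔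
        ∀ j, ∑ i, W' i j * (∑ k, gram φ t₀ h i k • W k) j =
          ∑ i, W' i j * (∫ τ in (0 : ℝ)..1, φ i (t₀ + τ * h) • f (u τ)) j := fun W' => by
      rw [pairing_sum_smul hφ W' hderivc.continuousOn,
        pairing_sum_smul hφ W' (hf.comp hu).continuousOn, ← WithLp.toLp_smul,
        (WithLp.toLp_injective 2).eq_iff, funext_iff]
      refine forall_congr' fun j => ?_
      simp only [hint, WithLp.ofLp_smul, Pi.smul_apply, smul_eq_mul, mul_left_comm _ h,
        ← Finset.mul_sum, Function.comp_apply]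
      exact mul_right_inj' hh
    constructor
    · intro H
      have h1 : ∀ i, ∑ k, gram φ t₀ h i k • W k =
          ∫ τ in (0 : ℝ)..1, φ i (t₀ + τ * h) • f (u τ) := fun i => by
        -- The pairing is entrywise, so `φ i` times the all-ones vector tests every coordinate at
        -- once.
        have h2 := (hv (Pi.single i (WithLp.toLp 2 fun _ => 1))).1
          (H _ ⟨_, ⟨_, fun t => rfl⟩, fun τ => rfl⟩)
        ext j
        have h3 := h2 j
        have hz : ∀ b : Fin r, (Pi.single i (WithLp.toLp 2 fun _ => 1) : Fin r → Phase d₁) b j =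
            if b = i then 1 else 0 := fun b => by
          rcases eq_or_ne b i with rfl | hb
          · simp
          · simp [hb]
        simpa only [hz, ite_mul, one_mul, zero_mul, Finset.sum_ite_eq', Finset.mem_univ, if_true]
          using h3
      funext k
      simp only [projCoeff, ← h1]
      rw [sum_smul_sum_smul, Matrix.nonsing_inv_mul _ hM, sum_one_smul]
    · rintro hWe v ⟨w, ⟨W', hw⟩, hvw⟩
      have hve : v = fun τ => ∑ i, φ i (t₀ + τ * h) • W' i := funext fun τ => by rw [hvw, hw]
      rw [hve, hv]
      intro j
      refine Finset.sum_congr rfl fun i _ => ?_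
      have hi : ∑ k, gram φ t₀ h i k • W k =
          ∫ τ in (0 : ℝ)..1, φ i (t₀ + τ * h) • f (u τ) := by
        simp only [hWe, projCoeff]
        rw [sum_smul_sum_smul, Matrix.mul_nonsing_inv _ hM, sum_one_smul]
      rw [hi]
  simp only [integral_proj hφ]
  constructor
  · rintro ⟨hX, h0, hvar⟩
    obtain ⟨V, W, hu⟩ := mem_rescale_spaceX_iff.1 hX
    have hd := hasDerivAt_of_eq_integral hφ hu
    have hV : V = y₀ := by simpa [h0] using (hu 0).symm
    have hW := (hpair W hd).1 hvar
    refine ⟨continuous_iff_continuousAt.2 fun τ => (hd τ).continuousAt, fun τ => ?_⟩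
    rw [hu τ, hV, hW]
  · rintro ⟨-, hu⟩
    refine ⟨mem_rescale_spaceX_iff.2 ⟨_, _, hu⟩, by simp [hu 0], ?_⟩
    exact (hpair _ (hasDerivAt_of_eq_integral hφ hu)).2 rfl

end Forms

/-! ### Regularity and local estimates -/

/-- Bootstrap: if `y` is `C^m`, then so is `y' = f ∘ y`, hence `y` is `C^(m+1)`. -/
theorem contDiffOn_of_hasDerivWithinAt {E : Type*} [NormedAddCommGroup E] [NormedSpace ℝ E]
    {f : E → E} {n : ℕ} (hf : ContDiff ℝ n f) {s : Set ℝ} (hs : UniqueDiffOn ℝ s) {y : ℝ → E}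
    (hy : ∀ t ∈ s, HasDerivWithinAt y (f (y t)) s t) : ContDiffOn ℝ n y s := by
  suffices h : ∀ m : ℕ, m ≤ n → ContDiffOn ℝ m y s from h n le_rfl
  intro m
  induction m with
  | zero => exact fun _ => contDiffOn_zero.2 fun t ht => (hy t ht).continuousWithinAt
  | succ m ih =>
    intro hm
    rw [Nat.cast_succ, contDiffOn_succ_iff_derivWithin hs]
    refine ⟨fun t ht => (hy t ht).differentiableWithinAt, by simp, ?_⟩
    have h1 : ContDiff ℝ m f := hf.of_le (by exact_mod_cast (Nat.le_of_succ_le hm))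
    exact (h1.comp_contDiffOn (ih (Nat.le_of_succ_le hm))).congr
      fun t ht => (hy t ht).derivWithin (hs t ht)

theorem exists_lipschitz_on_closedBall {E F : Type*} [NormedAddCommGroup E] [NormedSpace ℝ E]
    [ProperSpace E] [NormedAddCommGroup F] [NormedSpace ℝ F] {f : E → F} (hf : ContDiff ℝ 1 f)
    (x₀ : E) (R : ℝ) : ∃ L, 0 ≤ L ∧ ∀ x ∈ Metric.closedBall x₀ R, ∀ x' ∈ Metric.closedBall x₀ R,
      ‖f x - f x'‖ ≤ L * ‖x - x'‖ := by
  obtain ⟨L, hL⟩ := (isCompact_closedBall x₀ R).exists_bound_of_continuousOn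
    (hf.continuous_fderiv one_ne_zero).continuousOn
  refine ⟨|L|, abs_nonneg L, fun x hx x' hx' => ?_⟩
  exact (convex_closedBall x₀ R).norm_image_sub_le_of_norm_fderiv_le (𝕜 := ℝ)
    (fun z _ => hf.differentiable one_ne_zero z)
    (fun z hz => (hL z hz).trans (le_abs_self L)) hx' hx

theorem exists_quadratic_remainder {E : Type*} [NormedAddCommGroup E] [NormedSpace ℝ E]
    [ProperSpace E] {f : E → E} (hf : ContDiff ℝ 2 f) (x₀ : E) (R : ℝ) :
    ∃ L, 0 ≤ L ∧ ∀ x ∈ Metric.closedBall x₀ R, ∀ z ∈ Metric.closedBall x₀ R,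
      ‖f x - f z - fderiv ℝ f z (x - z)‖ ≤ L * ‖x - z‖ ^ 2 := by
  obtain ⟨L, hL0, hL⟩ := exists_lipschitz_on_closedBall
    (hf.fderiv_right (m := 1) (by norm_num)) x₀ R
  refine ⟨L, hL0, fun x hx z hz => ?_⟩
  have hseg := (convex_closedBall x₀ R).segment_subset hz hx
  have h := (convex_segment z x).norm_image_sub_le_of_norm_fderiv_le' (𝕜 := ℝ) (f := f)
    (φ := fderiv ℝ f z) (C := L * ‖x - z‖)
    (fun w _ => hf.differentiable two_ne_zero w)
    (fun w hw => (hL w (hseg hw) z hz).trans (mul_le_mul_of_nonneg_left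
      (norm_sub_le_of_mem_segment hw) hL0))
    (left_mem_segment ℝ z x) (right_mem_segment ℝ z x)
  rwa [mul_assoc, ← sq] at h

/-! ### Approximate fundamental solutions -/

/-- Picard iterates of `Z' = -Z A`, `Z(t₀) = 1`. -/
noncomputable def picardIterate {𝔸 : Type*} [NormedRing 𝔸] [NormedAlgebra ℝ 𝔸] (A : ℝ → 𝔸)
    (t₀ : ℝ) : ℕ → ℝ → 𝔸
  | 0 => fun _ => 1
  | n + 1 => fun t => 1 - ∫ s in t₀..t, picardIterate A t₀ n s * A s

section Picard

variable {𝔸 : Type*} [NormedRing 𝔸] [NormedAlgebra ℝ 𝔸] {A : ℝ → 𝔸} {t₀ : ℝ}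

theorem continuous_picardIterate (hA : Continuous A) : ∀ n, Continuous (picardIterate A t₀ n)
  | 0 => continuous_const
  | n + 1 => continuous_const.sub (intervalIntegral.continuous_primitive
      (fun a b => ((continuous_picardIterate hA n).mul hA).intervalIntegrable a b) t₀)

theorem picardIterate_self (n : ℕ) : picardIterate A t₀ n t₀ = 1 := by
  cases n <;> simp [picardIterate]

/-- Each difference of iterates is an integral of the previous one times `A`, which gains one power
of `t - t₀`. -/
theorem exists_picardIterate_sub_bound (hA : Continuous A) {a : ℝ} (ha : ∀ t, ‖A t‖ ≤ a) (n : ℕ) :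
    ∃ B, 0 ≤ B ∧ ∀ t, t₀ ≤ t →
      ‖picardIterate A t₀ (n + 1) t - picardIterate A t₀ n t‖ ≤ B * (t - t₀) ^ (n + 1) := by
  have ha0 : 0 ≤ a := (norm_nonneg _).trans (ha 0)
  induction n with
  | zero =>
    refine ⟨a, ha0, fun t ht => ?_⟩
    have := intervalIntegral.norm_integral_le_of_norm_le_const (a := t₀) (b := t) (f := A)
      fun s _ => ha s
    simpa [picardIterate, abs_of_nonneg (sub_nonneg.2 ht)] using this
  | succ n ih =>
    obtain ⟨B, hB0, hB⟩ := ih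
    refine ⟨B * a, by positivity, fun t ht => ?_⟩
    have hsub : picardIterate A t₀ (n + 2) t - picardIterate A t₀ (n + 1) t =
        -∫ s in t₀..t, (picardIterate A t₀ (n + 1) s - picardIterate A t₀ n s) * A s := by
      have h1 := intervalIntegral.integral_sub (μ := MeasureTheory.volume)
        (((continuous_picardIterate (t₀ := t₀) hA (n + 1)).mul hA).intervalIntegrable t₀ t)
        (((continuous_picardIterate (t₀ := t₀) hA n).mul hA).intervalIntegrable t₀ t)
      simp only [sub_mul]
      change _ = -∫ s in t₀..t, (picardIterate A t₀ (n + 1) * A) s - (picardIterate A t₀ n * A) s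
      rw [h1, neg_sub]
      exact sub_sub_sub_cancel_left _ _ (1 : 𝔸)
    rw [hsub, norm_neg]
    refine (intervalIntegral.norm_integral_le_of_norm_le_const
      (C := B * (t - t₀) ^ (n + 1) * a) fun s hs => ?_).trans (le_of_eq ?_)
    · rw [Set.uIoc_of_le ht] at hs
      have h0 : 0 ≤ s - t₀ := by linarith [hs.1]
      refine (norm_mul_le _ _).trans (mul_le_mul ((hB s hs.1.le).trans ?_) (ha s)
        (norm_nonneg _) ?_)
      · gcongr
        exact hs.2
      · have := sub_nonneg.2 ht
        positivity
    · rw [abs_of_nonneg (sub_nonneg.2 ht)]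
      ring

variable [CompleteSpace 𝔸]

theorem hasDerivAt_picardIterate (hA : Continuous A) (n : ℕ) (t : ℝ) :
    HasDerivAt (picardIterate A t₀ (n + 1)) (-(picardIterate A t₀ n t * A t)) t :=
  (((continuous_picardIterate hA n).mul hA).integral_hasStrictDerivAt t₀ t).hasDerivAt.const_sub 1

theorem contDiffOn_picardIterate (hA : Continuous A) {s : Set ℝ} (hs : UniqueDiffOn ℝ s) {r : ℕ}
    (hAs : ContDiffOn ℝ r A s) (n : ℕ) : ContDiffOn ℝ r (picardIterate A t₀ n) s := by
  induction n with
  | zero => exact contDiffOn_const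
  | succ n ih =>
    have h1 : ContDiffOn ℝ ((r : WithTop ℕ∞) + 1) (picardIterate A t₀ (n + 1)) s := by
      rw [contDiffOn_succ_iff_derivWithin hs]
      refine ⟨fun t _ => (hasDerivAt_picardIterate hA n t).differentiableAt.differentiableWithinAt,
        by simp, (ih.mul hAs).neg.congr fun t ht => ?_⟩
      exact (hasDerivAt_picardIterate hA n t).hasDerivWithinAt.derivWithin (hs t ht)
    exact h1.of_le le_self_add

/-- An approximate solution suffices: for `Z` the iterate of index `r + 1`, the residual `Z' + Z A`
is the difference of the last two iterates times `A`. -/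
theorem exists_approx_fundamental_solution {T : ℝ} (hT : t₀ < T) {r : ℕ}
    (hA : ContDiffOn ℝ r A (Set.Icc t₀ T)) :
    ∃ Z Z' : ℝ → 𝔸, Z t₀ = 1 ∧ Continuous Z ∧ ContDiffOn ℝ r Z (Set.Icc t₀ T) ∧
      Continuous Z' ∧ (∀ t, HasDerivAt Z (Z' t) t) ∧
      ∃ B, 0 ≤ B ∧ ∀ t ∈ Set.Icc t₀ T, ‖Z' t + Z t * A t‖ ≤ B * (t - t₀) ^ (r + 1) := by
  -- Constant extension beyond the interval keeps `A` continuous and bounded, so the iterates are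
  -- differentiable on all of `ℝ`.
  let A' : ℝ → 𝔸 := Set.IccExtend hT.le ((Set.Icc t₀ T).domRestrict A)
  have hA' : Continuous A' :=
    (continuousOn_iff_continuous_domRestrict.1 hA.continuousOn).Icc_extend'
  have hAA : ∀ t ∈ Set.Icc t₀ T, A' t = A t := fun t ht => Set.IccExtend_of_mem _ _ ht
  obtain ⟨a, ha⟩ := isCompact_Icc.exists_bound_of_continuousOn hA.continuousOn
  have ha' : ∀ t, ‖A' t‖ ≤ a := fun t => ha _ (Set.projIcc t₀ T hT.le t).2
  have ha0 : 0 ≤ a := (norm_nonneg _).trans (ha' 0)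
  obtain ⟨B, hB0, hB⟩ := exists_picardIterate_sub_bound (t₀ := t₀) hA' ha' r
  refine ⟨picardIterate A' t₀ (r + 1), fun t => -(picardIterate A' t₀ r t * A' t),
    picardIterate_self _, continuous_picardIterate hA' _,
    contDiffOn_picardIterate hA' (uniqueDiffOn_Icc hT) (hA.congr hAA) _,
    ((continuous_picardIterate hA' _).mul hA').neg, hasDerivAt_picardIterate hA' r,
    B * a, by positivity, fun t ht => ?_⟩
  rw [← hAA t ht, neg_add_eq_sub, ← sub_mul]
  refine (norm_mul_le _ _).trans ?_
  calc _ ≤ B * (t - t₀) ^ (r + 1) * a := by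
        refine mul_le_mul (hB t ht.1) (ha' t) (norm_nonneg _) ?_
        have := sub_nonneg.2 ht.1
        positivity
    _ = _ := by ring

end Picard

/-! ### Error estimates for one step -/

section Errors

variable {E : Type*} [NormedAddCommGroup E] [NormedSpace ℝ E] [CompleteSpace E]
variable {r : ℕ} {φ : Fin r → ℝ → ℝ} {t₀ T h : ℝ} {f : E → E} {y₀ : E} {y u : ℝ → E} {s : Set E}
variable {K L : ℝ}

theorem affine_mem_Icc (hh : 0 ≤ h) (hhT : t₀ + h ≤ T) {τ : ℝ} (hτ : τ ∈ Set.Icc (0 : ℝ) 1) :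
    t₀ + τ * h ∈ Set.Icc t₀ T := by
  have h1 := mul_nonneg hτ.1 hh
  have h2 := mul_le_of_le_one_left hh hτ.2
  constructor <;> linarith

theorem affine_mem_Ioo (hh : 0 < h) (hhT : t₀ + h ≤ T) {τ : ℝ} (hτ : τ ∈ Set.Ioo (0 : ℝ) 1) :
    t₀ + τ * h ∈ Set.Ioo t₀ T := by
  have h1 := mul_pos hτ.1 hh
  have h2 := mul_lt_of_lt_one_left hh hτ.2
  constructor <;> linarith

theorem hasDerivAt_comp_affine {F : Type*} [NormedAddCommGroup F] [NormedSpace ℝ F] {g : ℝ → F}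
    {g' : F} {τ : ℝ} (hg : HasDerivAt g g' (t₀ + τ * h)) :
    HasDerivAt (fun τ => g (t₀ + τ * h)) (h • g') τ := by
  have := hg.scomp τ (((hasDerivAt_id τ).mul_const h).const_add t₀)
  rw [one_mul] at this
  exact this

theorem continuousOn_comp_affine {F : Type*} [TopologicalSpace F] {g : ℝ → F}
    (hg : ContinuousOn g (Set.Icc t₀ T)) (hh : 0 ≤ h) (hhT : t₀ + h ≤ T) :
    ContinuousOn (fun τ => g (t₀ + τ * h)) (Set.Icc 0 1) :=
  hg.comp (by fun_prop) fun _ hτ => affine_mem_Icc hh hhT hτ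

theorem ivp_rescaled_eq_integral (hfc : ContinuousOn f s)
    (hy : ∀ t ∈ Set.Icc t₀ T, HasDerivWithinAt y (f (y t)) (Set.Icc t₀ T) t)
    (hys : ∀ t ∈ Set.Icc t₀ T, y t ∈ s) (hh : 0 < h) (hhT : t₀ + h ≤ T) {τ : ℝ}
    (hτ : τ ∈ Set.Icc (0 : ℝ) 1) :
    y (t₀ + τ * h) = y t₀ + h • ∫ α in (0 : ℝ)..τ, f (y (t₀ + α * h)) := by
  have hyc : ContinuousOn y (Set.Icc t₀ T) := fun t ht => (hy t ht).continuousWithinAt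
  have hsub : Set.Icc 0 τ ⊆ Set.Icc (0 : ℝ) 1 := Set.Icc_subset_Icc_right hτ.2
  have hint := intervalIntegral.integral_eq_sub_of_hasDerivAt_of_le (a := 0) (b := τ)
    (f := fun α => y (t₀ + α * h)) (f' := fun α => h • f (y (t₀ + α * h))) hτ.1
    ((continuousOn_comp_affine hyc hh.le hhT).mono hsub)
    (fun α hα => by
      have hmem := affine_mem_Ioo hh hhT ⟨hα.1, hα.2.trans_le hτ.2⟩
      exact hasDerivAt_comp_affine ((hy _ (Set.Ioo_subset_Icc_self hmem)).hasDerivAt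
        (Icc_mem_nhds hmem.1 hmem.2)))
    (((continuousOn_comp_affine (hfc.comp hyc hys) hh.le hhT).mono hsub).const_smul h
      |>.intervalIntegrable_of_Icc hτ.1)
  rw [intervalIntegral.integral_smul] at hint
  rw [hint]
  simp

/-- The maximal error `δ` satisfies `δ ≤ h * (K * L * δ + (K + 1) * B)`, from the Lipschitz bound
and the projection defect of `f ∘ y`. Absorbing the first term, at most `δ / 2`, produces the factor
2. -/
theorem stage_error_le (hφ : ∀ i, Continuous (φ i)) (hu : IsUnit (gram φ t₀ h).det)
    (hK : ∀ τ ∈ Set.Icc (0 : ℝ) 1, ∀ σ ∈ Set.Icc (0 : ℝ) 1, |kernelP φ t₀ h τ σ| ≤ K)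
    (hfc : ContinuousOn f s) (hL : ∀ x ∈ s, ∀ x' ∈ s, ‖f x - f x'‖ ≤ L * ‖x - x'‖) (hL0 : 0 ≤ L)
    (hy : ∀ t ∈ Set.Icc t₀ T, HasDerivWithinAt y (f (y t)) (Set.Icc t₀ T) t)
    (hys : ∀ t ∈ Set.Icc t₀ T, y t ∈ s) (hh : 0 < h) (hhT : t₀ + h ≤ T)
    (hhL : h * (K * L) ≤ 1 / 2)
    {c : Fin r → E} {B : ℝ} (hB : ∀ σ ∈ Set.Icc (0 : ℝ) 1,
      ‖f (y (t₀ + σ * h)) - ∑ i, φ i (t₀ + σ * h) • c i‖ ≤ B)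
    (huc : ContinuousOn u (Set.Icc 0 1)) (hus : ∀ τ ∈ Set.Icc (0 : ℝ) 1, u τ ∈ s)
    (hue : ∀ τ ∈ Set.Icc (0 : ℝ) 1,
      u τ = y t₀ + h • ∫ α in (0 : ℝ)..τ, proj φ t₀ h (fun σ => f (u σ)) α) :
    ∀ τ ∈ Set.Icc (0 : ℝ) 1, ‖u τ - y (t₀ + τ * h)‖ ≤ 2 * (K + 1) * B * h := by
  have hyc : ContinuousOn y (Set.Icc t₀ T) := fun t ht => (hy t ht).continuousWithinAt
  have hzc := continuousOn_comp_affine hyc hh.le hhT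
  have hzs : ∀ τ ∈ Set.Icc (0 : ℝ) 1, y (t₀ + τ * h) ∈ s :=
    fun τ hτ => hys _ (affine_mem_Icc hh.le hhT hτ)
  have hfz : ContinuousOn (fun τ => f (y (t₀ + τ * h))) (Set.Icc 0 1) := hfc.comp hzc hzs
  have hfu : ContinuousOn (fun τ => f (u τ)) (Set.Icc 0 1) := hfc.comp huc hus
  obtain ⟨τ₁, hτ₁, hmax⟩ := isCompact_Icc.exists_isMaxOn (Set.nonempty_Icc.2 zero_le_one)
    (huc.sub hzc).norm
  set δ := ‖u τ₁ - y (t₀ + τ₁ * h)‖ with hδ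
  have hle : ∀ τ ∈ Set.Icc (0 : ℝ) 1, ‖u τ - y (t₀ + τ * h)‖ ≤ δ := fun τ hτ => hmax hτ
  have hpt : ∀ τ ∈ Set.Icc (0 : ℝ) 1,
      ‖proj φ t₀ h (fun σ => f (u σ)) τ - f (y (t₀ + τ * h))‖ ≤ K * (L * δ) + (K + 1) * B :=
    fun τ hτ => by
    have h1 := norm_proj_le (g := fun σ => f (u σ) - f (y (t₀ + σ * h))) hφ (hfu.sub hfz) hK
      (fun σ hσ => (hL _ (hus σ hσ) _ (hzs σ hσ)).trans
        (mul_le_mul_of_nonneg_left (hle σ hσ) hL0)) hτ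
    rw [proj_sub hφ hfu hfz] at h1
    have h2 := norm_proj_sub_self_le hφ hu hfz hK c hB hτ
    calc _ = ‖(proj φ t₀ h (fun σ => f (u σ)) τ - proj φ t₀ h (fun σ => f (y (t₀ + σ * h))) τ)
          + (proj φ t₀ h (fun σ => f (y (t₀ + σ * h))) τ - f (y (t₀ + τ * h)))‖ := by
            rw [sub_add_sub_cancel]
      _ ≤ _ := (norm_add_le _ _).trans (add_le_add h1 h2)
  have hstep : δ ≤ h * (K * (L * δ) + (K + 1) * B) := by
    conv_lhs => rw [hδ, hue τ₁ hτ₁, ivp_rescaled_eq_integral hfc hy hys hh hhT hτ₁]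
    rw [add_sub_add_left_eq_sub, ← smul_sub, norm_smul, Real.norm_of_nonneg hh.le,
      ← intervalIntegral.integral_sub ((continuous_proj hφ _).intervalIntegrable _ _)
        ((hfz.mono (Set.Icc_subset_Icc_right hτ₁.2)).intervalIntegrable_of_Icc hτ₁.1)]
    refine mul_le_mul_of_nonneg_left ((intervalIntegral.norm_integral_le_of_norm_le_const
      (C := K * (L * δ) + (K + 1) * B) fun α hα => ?_).trans ?_) hh.le
    · rw [Set.uIoc_of_le hτ₁.1] at hα
      exact hpt α ⟨hα.1.le, hα.2.trans hτ₁.2⟩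
    · rw [sub_zero, abs_of_nonneg hτ₁.1]
      exact mul_le_of_le_one_right ((norm_nonneg _).trans (hpt τ₁ hτ₁)) hτ₁.2
  have hδ0 : 0 ≤ δ := norm_nonneg _
  intro τ hτ
  refine (hle τ hτ).trans ?_
  have := mul_le_mul_of_nonneg_right hhL hδ0
  linarith

/-- The defect of the projection is orthogonal to operator-valued weights in the span. -/
theorem integral_clm_approx_eq_zero (hφ : ∀ i, Continuous (φ i))
    (hu : IsUnit (gram φ t₀ h).det) {g : ℝ → E} (hg : ContinuousOn g (Set.Icc 0 1))
    (c : Fin r → E →L[ℝ] E) :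
    ∫ τ in (0 : ℝ)..1, (∑ i, φ i (t₀ + τ * h) • c i) (proj φ t₀ h g τ - g τ) = 0 := by
  have hP := (continuous_proj (t₀ := t₀) (h := h) hφ g).continuousOn (s := Set.Icc 0 1)
  have hint : ∀ i, IntervalIntegrable (fun τ => φ i (t₀ + τ * h) • (proj φ t₀ h g τ - g τ))
      MeasureTheory.volume 0 1 := fun i =>
    intervalIntegrable_smul_of_continuousOn (continuous_comp_affine hφ i) (hP.sub hg)
  have hrw : ∀ τ, (∑ i, φ i (t₀ + τ * h) • c i) (proj φ t₀ h g τ - g τ) =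
      ∑ i, c i (φ i (t₀ + τ * h) • (proj φ t₀ h g τ - g τ)) := fun τ => by
    simp only [sum_apply, smul_apply, map_smul]
  simp only [hrw]
  rw [intervalIntegral.integral_finsetSum fun i _ => ?_]
  · refine Finset.sum_eq_zero fun i _ => ?_
    rw [(c i).intervalIntegral_comp_comm (hint i)]
    simp only [smul_sub]
    rw [intervalIntegral.integral_sub
      (intervalIntegrable_smul_of_continuousOn (continuous_comp_affine hφ i) hP)
      (intervalIntegrable_smul_of_continuousOn (continuous_comp_affine hφ i) hg),
      integral_smul_proj hφ hu, sub_self, map_zero]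
  · exact ((c i).continuous.comp_continuousOn
      ((continuous_comp_affine hφ i).continuousOn.smul (hP.sub hg))).intervalIntegrable_of_Icc
      zero_le_one

/-- With `e = u - y`, the error `Z e` vanishes at `τ = 0` and its derivative is `h` times `(Z' + Z
A) e + Z (f(u) - f(y) - A e) + Z (P - f(u))`. Orthogonality of `P - f(u)` to the span allows `∑ φ i
• c i` to be subtracted from the last weight; the three bounds correspond to the three terms. -/
theorem weighted_endpoint_error_le (hφ : ∀ i, Continuous (φ i)) (hu : IsUnit (gram φ t₀ h).det)
    (hfc : ContinuousOn f s)
    (hy : ∀ t ∈ Set.Icc t₀ T, HasDerivWithinAt y (f (y t)) (Set.Icc t₀ T) t)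
    (hys : ∀ t ∈ Set.Icc t₀ T, y t ∈ s) (hh : 0 < h) (hhT : t₀ + h ≤ T)
    {A Z Z' : ℝ → E →L[ℝ] E} (hZc : Continuous Z) (hZ'c : Continuous Z')
    (hZ : ∀ t, HasDerivAt Z (Z' t) t)
    {ε ρ q M ζ η : ℝ} (c : Fin r → E →L[ℝ] E)
    (hε : ∀ τ ∈ Set.Icc (0 : ℝ) 1, ‖u τ - y (t₀ + τ * h)‖ ≤ ε)
    (hρ : ∀ τ ∈ Set.Icc (0 : ℝ) 1,
      ‖Z' (t₀ + τ * h) + Z (t₀ + τ * h) * A (t₀ + τ * h)‖ ≤ ρ)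
    (hq : ∀ τ ∈ Set.Icc (0 : ℝ) 1, ‖f (u τ) - f (y (t₀ + τ * h)) -
      A (t₀ + τ * h) (u τ - y (t₀ + τ * h))‖ ≤ q)
    (hM : ∀ τ ∈ Set.Icc (0 : ℝ) 1, ‖Z (t₀ + τ * h)‖ ≤ M)
    (hζ : ∀ τ ∈ Set.Icc (0 : ℝ) 1, ‖Z (t₀ + τ * h) - ∑ i, φ i (t₀ + τ * h) • c i‖ ≤ ζ)
    (hη : ∀ τ ∈ Set.Icc (0 : ℝ) 1, ‖proj φ t₀ h (fun σ => f (u σ)) τ - f (u τ)‖ ≤ η)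
    (huc : ContinuousOn u (Set.Icc 0 1)) (hus : ∀ τ ∈ Set.Icc (0 : ℝ) 1, u τ ∈ s)
    (hue : ∀ τ ∈ Set.Icc (0 : ℝ) 1,
      u τ = y t₀ + h • ∫ α in (0 : ℝ)..τ, proj φ t₀ h (fun σ => f (u σ)) α) :
    ‖Z (t₀ + h) (u 1 - y (t₀ + h))‖ ≤ h * (ρ * ε + M * q + ζ * η) := by
  set P := proj φ t₀ h (fun σ => f (u σ)) with hPdef
  have hPc : Continuous P := continuous_proj hφ _
  have hyc : ContinuousOn y (Set.Icc t₀ T) := fun t ht => (hy t ht).continuousWithinAt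
  have hzc := continuousOn_comp_affine hyc hh.le hhT
  have hfz : ContinuousOn (fun τ => f (y (t₀ + τ * h))) (Set.Icc 0 1) :=
    hfc.comp hzc fun τ hτ => hys _ (affine_mem_Icc hh.le hhT hτ)
  have hfu : ContinuousOn (fun τ => f (u τ)) (Set.Icc 0 1) := hfc.comp huc hus
  have hZτ : Continuous fun τ => Z (t₀ + τ * h) := by fun_prop
  have hZ'τ : Continuous fun τ => Z' (t₀ + τ * h) := by fun_prop
  have hWτ : Continuous fun τ => ∑ i, φ i (t₀ + τ * h) • c i :=
    continuous_finsetSum _ fun i _ => (continuous_comp_affine hφ i).smul continuous_const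
  let I : ℝ → E := fun τ => Z' (t₀ + τ * h) (u τ - y (t₀ + τ * h)) +
    Z (t₀ + τ * h) (P τ - f (y (t₀ + τ * h)))
  -- The term of zero integral that is subtracted from the scaled derivative `I` of `Z e`.
  let J : ℝ → E := fun τ => (∑ i, φ i (t₀ + τ * h) • c i) (P τ - f (u τ))
  have hIc : ContinuousOn I (Set.Icc 0 1) :=
    (hZ'τ.continuousOn.clm_apply (huc.sub hzc)).add
      (hZτ.continuousOn.clm_apply (hPc.continuousOn.sub hfz))
  have hJc : ContinuousOn J (Set.Icc 0 1) :=
    hWτ.continuousOn.clm_apply (hPc.continuousOn.sub hfu)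
  have hJ0 : ∫ τ in (0 : ℝ)..1, J τ = 0 := integral_clm_approx_eq_zero hφ hu hfu c
  have hftc : ∫ τ in (0 : ℝ)..1, h • I τ = Z (t₀ + h) (u 1 - y (t₀ + h)) := by
    have hint := intervalIntegral.integral_eq_sub_of_hasDerivAt_of_le (a := 0) (b := 1)
      (f := fun τ => Z (t₀ + τ * h) (u τ - y (t₀ + τ * h))) (f' := fun τ => h • I τ) zero_le_one
      (hZτ.continuousOn.clm_apply (huc.sub hzc))
      (fun τ hτ => by
        have hmem := affine_mem_Ioo hh hhT hτ
        have hyd : HasDerivAt (fun τ => y (t₀ + τ * h)) (h • f (y (t₀ + τ * h))) τ :=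
          hasDerivAt_comp_affine ((hy _ (Set.Ioo_subset_Icc_self hmem)).hasDerivAt
            (Icc_mem_nhds hmem.1 hmem.2))
        have hud : HasDerivAt u (h • P τ) τ := by
          have h1 : HasDerivAt (fun τ => y t₀ + h • ∫ α in (0 : ℝ)..τ, P α) (h • P τ) τ :=
            ((hPc.integral_hasStrictDerivAt 0 τ).hasDerivAt.fun_const_smul h).const_add _
          refine h1.congr_of_eventuallyEq ?_
          filter_upwards [Icc_mem_nhds hτ.1 hτ.2] with σ hσ using hue σ hσ
        have hd := (hasDerivAt_comp_affine (hZ (t₀ + τ * h))).clm_apply (hud.fun_sub hyd)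
        convert hd using 1
        simp only [I, smul_apply, ← smul_sub, map_smul, smul_add])
      ((hIc.const_smul h).intervalIntegrable_of_Icc zero_le_one)
    have hu0 : u 0 = y t₀ := by simpa using hue 0 ⟨le_rfl, zero_le_one⟩
    rw [hint]
    simp [hu0]
  have hsplit : ∫ τ in (0 : ℝ)..1, h • I τ = h • ∫ τ in (0 : ℝ)..1, (I τ - J τ) := by
    rw [intervalIntegral.integral_smul, intervalIntegral.integral_sub
      (hIc.intervalIntegrable_of_Icc zero_le_one) (hJc.intervalIntegrable_of_Icc zero_le_one),
      hJ0, sub_zero]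
  rw [← hftc, hsplit, norm_smul, Real.norm_of_nonneg hh.le]
  refine mul_le_mul_of_nonneg_left ((intervalIntegral.norm_integral_le_of_norm_le_const
    (C := ρ * ε + M * q + ζ * η) fun τ hτ => ?_).trans (by simp)) hh.le
  rw [Set.uIoc_of_le zero_le_one] at hτ
  have hτ' := Set.Ioc_subset_Icc_self hτ
  have hIJ : I τ - J τ =
      (Z' (t₀ + τ * h) + Z (t₀ + τ * h) * A (t₀ + τ * h)) (u τ - y (t₀ + τ * h)) +
      Z (t₀ + τ * h) (f (u τ) - f (y (t₀ + τ * h)) - A (t₀ + τ * h) (u τ - y (t₀ + τ * h))) +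
      (Z (t₀ + τ * h) - ∑ i, φ i (t₀ + τ * h) • c i) (P τ - f (u τ)) := by
    simp only [I, J, add_apply, sub_apply,
      mul_apply_eq_comp, map_sub]
    abel
  rw [hIJ]
  refine (norm_add₃_le).trans (add_le_add (add_le_add ?_ ?_) ?_)
  · exact ContinuousLinearMap.le_of_opNorm_le_of_le _ (hρ τ hτ') (hε τ hτ')
  · exact ContinuousLinearMap.le_of_opNorm_le_of_le _ (hM τ hτ') (hq τ hτ')
  · exact ContinuousLinearMap.le_of_opNorm_le_of_le _ (hζ τ hτ') (hη τ hτ')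

end Errors

/-! ### Order of the method -/

section Order

variable {E : Type*} [NormedAddCommGroup E] [NormedSpace ℝ E] [CompleteSpace E] [ProperSpace E]
variable {r : ℕ} {φ : Fin r → ℝ → ℝ} {t₀ T : ℝ} {f : E → E} {y₀ : E} {y : ℝ → E}

theorem eventually_step_small {a b : ℝ} (hb : 0 < b) :
    ∀ᶠ h in nhdsWithin (0 : ℝ) (Set.Ioi 0), h * a ≤ b := by
  have hc : Continuous fun h : ℝ => h * a := by fun_prop
  have h1 : ∀ᶠ h in nhds (0 : ℝ), h * a < b :=
    hc.continuousAt.eventually_lt_const (by simpa using hb)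
  exact (h1.filter_mono nhdsWithin_le_nhds).mono fun _ hh => hh.le

/-- Residual times stage error, quadratic remainder, and approximation error of `Z` times projection
defect are each `O(h^(2r))`; integration adds a factor `h`. The condition `1 ≤ r` makes `f` of class
`C²`, as the quadratic remainder requires. -/
theorem exists_endpoint_bound (hr : 1 ≤ r) (hφ : ∀ i, Continuous (φ i))
    {S : Matrix (Fin r) (Fin r) ℝ} {C : ℝ} (hC : 0 ≤ C)
    (hSC : ∀ k, ∀ t ∈ Set.Icc t₀ (t₀ + 1),
      |(S *ᵥ fun i => φ i t) k - (t - t₀) ^ (k : ℕ)| ≤ C * (t - t₀) ^ r)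
    (hf : ContDiff ℝ ((r + 1 : ℕ) : WithTop ℕ∞) f) (hT : t₀ < T)
    (hy : ∀ t ∈ Set.Icc t₀ T, HasDerivWithinAt y (f (y t)) (Set.Icc t₀ T) t)
    {R' : ℝ} (hys : ∀ t ∈ Set.Icc t₀ T, y t ∈ Metric.closedBall y₀ R') {K Ce : ℝ} (hK0 : 0 ≤ K)
    (hCe : 0 ≤ Ce) :
    ∃ C₁, 0 ≤ C₁ ∧ ∀ᶠ h in nhdsWithin (0 : ℝ) (Set.Ioi 0), ∀ u : ℝ → E,
      IsUnit (gram φ t₀ h).det →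
      (∀ τ ∈ Set.Icc (0 : ℝ) 1, ∀ σ ∈ Set.Icc (0 : ℝ) 1, |kernelP φ t₀ h τ σ| ≤ K) →
      ContinuousOn u (Set.Icc 0 1) →
      (∀ τ ∈ Set.Icc (0 : ℝ) 1, u τ ∈ Metric.closedBall y₀ R') →
      (∀ τ ∈ Set.Icc (0 : ℝ) 1,
        u τ = y t₀ + h • ∫ α in (0 : ℝ)..τ, proj φ t₀ h (fun σ => f (u σ)) α) →
      (∀ τ ∈ Set.Icc (0 : ℝ) 1, ‖u τ - y (t₀ + τ * h)‖ ≤ Ce * h ^ (r + 1)) →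
      ‖u 1 - y (t₀ + h)‖ ≤ C₁ * h ^ (2 * r + 1) := by
  have hy1 : ContDiffOn ℝ r y (Set.Icc t₀ T) := by
    refine (contDiffOn_of_hasDerivWithinAt hf (uniqueDiffOn_Icc hT) hy).of_le ?_
    exact_mod_cast Nat.le_succ r
  have hfr : ContDiff ℝ r f := hf.of_le (by exact_mod_cast Nat.le_succ r)
  have hf1 : ContDiff ℝ 1 f := hf.of_le (by exact_mod_cast Nat.succ_le_succ (Nat.zero_le r))
  have hf2 : ContDiff ℝ 2 f := hf.of_le (by exact_mod_cast Nat.succ_le_succ hr)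
  obtain ⟨L, hL0, hL⟩ := exists_lipschitz_on_closedBall hf1 y₀ R'
  obtain ⟨L₂, hL₂0, hL₂⟩ := exists_quadratic_remainder hf2 y₀ R'
  obtain ⟨cg, Bg, hBg0, hBg⟩ := exists_approx hC hT hSC (hfr.comp_contDiffOn hy1)
  have hA : ContDiffOn ℝ r (fun t => fderiv ℝ f (y t)) (Set.Icc t₀ T) :=
    (hf.fderiv_right (m := (r : WithTop ℕ∞)) (by norm_cast)).comp_contDiffOn hy1
  obtain ⟨Z, Z', hZ0, hZc, hZr, hZ'c, hZd, Bρ, hBρ0, hBρ⟩ :=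
    exists_approx_fundamental_solution hT hA
  obtain ⟨cZ, BZ, hBZ0, hBZ⟩ := exists_approx hC hT hSC hZr
  obtain ⟨M, hM⟩ := (isCompact_Icc (a := t₀) (b := T)).exists_bound_of_continuousOn
    hZc.continuousOn
  have hM0 : 0 ≤ M := (norm_nonneg _).trans (hM t₀ ⟨le_rfl, hT.le⟩)
  let G : ℝ := Bρ * Ce + M * (L₂ * Ce ^ 2) + BZ * ((K + 1) * (L * Ce + Bg))
  have hZ1 : ∀ᶠ h in nhdsWithin (0 : ℝ) (Set.Ioi 0), ‖Z (t₀ + h) - 1‖ < 1 / 2 := by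
    have hc : Continuous fun h => ‖Z (t₀ + h) - 1‖ := by fun_prop
    have h1 : ∀ᶠ h in nhds (0 : ℝ), ‖Z (t₀ + h) - 1‖ < 1 / 2 :=
      hc.continuousAt.eventually_lt_const (by simp [hZ0])
    exact h1.filter_mono nhdsWithin_le_nhds
  refine ⟨2 * G, by positivity, ?_⟩
  filter_upwards [hZ1, Ioc_mem_nhdsGT one_pos, Ioc_mem_nhdsGT (sub_pos.2 hT)] with
    h hZh hh1 hhT' u hu hK huc hus hue hstage
  have hh : 0 < h := hh1.1
  have hhT : t₀ + h ≤ T := by linarith [hhT'.2]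
  have hmem : ∀ τ ∈ Set.Icc (0 : ℝ) 1, t₀ + τ * h ∈ Set.Icc t₀ T :=
    fun τ hτ => affine_mem_Icc hh.le hhT hτ
  have hmem1 : ∀ τ ∈ Set.Icc (0 : ℝ) 1, t₀ + τ * h ≤ t₀ + 1 :=
    fun τ hτ => (affine_mem_Icc (T := t₀ + 1) hh.le (by linarith [hh1.2]) hτ).2
  have hpow : ∀ (n : ℕ), ∀ τ ∈ Set.Icc (0 : ℝ) 1, (t₀ + τ * h - t₀) ^ n ≤ h ^ n :=
    fun n τ hτ => by
    rw [add_sub_cancel_left]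
    exact pow_le_pow_left₀ (mul_nonneg hτ.1 hh.le) (mul_le_of_le_one_left hh.le hτ.2) n
  have hpr : h ^ (r + 1) ≤ h ^ r := pow_le_pow_of_le_one hh.le hh1.2 (Nat.le_succ r)
  have hkey := weighted_endpoint_error_le (A := fun t => fderiv ℝ f (y t))
    (s := Metric.closedBall y₀ R')
    -- Sharper rates are weakened to `h ^ r`, so that the sum is exactly `G * h ^ (2 * r)`.
    (ε := Ce * h ^ r) (ρ := Bρ * h ^ r) (q := L₂ * (Ce * h ^ r) ^ 2) (M := M)
    (ζ := BZ * h ^ r) (η := (K + 1) * ((L * Ce + Bg) * h ^ r))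
    hφ hu hf.continuous.continuousOn hy hys hh hhT hZc hZ'c hZd cZ
    (fun τ hτ => (hstage τ hτ).trans (by gcongr))
    (fun τ hτ => (hBρ _ (hmem τ hτ)).trans
      (mul_le_mul_of_nonneg_left ((hpow _ τ hτ).trans hpr) hBρ0))
    (fun τ hτ => (hL₂ _ (hus τ hτ) _ (hys _ (hmem τ hτ))).trans (by
      have := hstage τ hτ
      gcongr
      exact this.trans (by gcongr)))
    (fun τ hτ => hM _ (hmem τ hτ))
    (fun τ hτ => (hBZ _ (hmem τ hτ) (hmem1 τ hτ)).trans
      (mul_le_mul_of_nonneg_left (hpow _ τ hτ) hBZ0))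
    -- The approximant `cg` of `f ∘ y` serves `f ∘ u` too, at the cost of `L` times the stage error.
    (fun τ hτ => norm_proj_sub_self_le hφ hu (hf.continuous.comp_continuousOn huc) hK cg
      (fun σ hσ => by
        have h1 := (hL _ (hus σ hσ) _ (hys _ (hmem σ hσ))).trans
          (mul_le_mul_of_nonneg_left ((hstage σ hσ).trans
            (mul_le_mul_of_nonneg_left hpr hCe)) hL0)
        have h2 := (hBg _ (hmem σ hσ) (hmem1 σ hσ)).trans
          (mul_le_mul_of_nonneg_left (hpow _ σ hσ) hBg0)
        calc _ = ‖(f (u σ) - f (y (t₀ + σ * h))) +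
              (f (y (t₀ + σ * h)) - ∑ i, φ i (t₀ + σ * h) • cg i)‖ := by
                rw [sub_add_sub_cancel]; rfl
          _ ≤ L * (Ce * h ^ r) + Bg * h ^ r := (norm_add_le _ _).trans (add_le_add h1 h2)
          _ = (L * Ce + Bg) * h ^ r := by ring) hτ)
    huc hus hue
  have hG : h * (Bρ * h ^ r * (Ce * h ^ r) + M * (L₂ * (Ce * h ^ r) ^ 2) +
      BZ * h ^ r * ((K + 1) * ((L * Ce + Bg) * h ^ r))) = G * h ^ (2 * r + 1) := by
    simp only [G]
    ring
  rw [hG] at hkey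
  set e := u 1 - y (t₀ + h)
  -- As `Z(t₀) = 1`, the weight is within `1/2` of the identity for small `h`; removing it costs the
  -- factor 2 in `2 * G`.
  have he : ‖e‖ ≤ ‖Z (t₀ + h) e‖ + 1 / 2 * ‖e‖ := by
    have h1 : e = Z (t₀ + h) e - (Z (t₀ + h) - 1) e := by
      simp
    calc ‖e‖ = ‖Z (t₀ + h) e - (Z (t₀ + h) - 1) e‖ := by rw [← h1]
      _ ≤ _ := (norm_sub_le _ _).trans (add_le_add le_rfl
        (ContinuousLinearMap.le_of_opNorm_le _ hZh.le e))
  linarith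

theorem exists_local_error_bound (hφ : ∀ i, Continuous (φ i))
    {S : Matrix (Fin r) (Fin r) ℝ} (hS : IsUnit S.det) {C : ℝ} (hC : 0 ≤ C)
    (hSC : ∀ k, ∀ t ∈ Set.Icc t₀ (t₀ + 1),
      |(S *ᵥ fun i => φ i t) k - (t - t₀) ^ (k : ℕ)| ≤ C * (t - t₀) ^ r)
    (hf : ContDiff ℝ ((r + 1 : ℕ) : WithTop ℕ∞) f) (hT : t₀ < T)
    (hy : ∀ t ∈ Set.Icc t₀ T, HasDerivWithinAt y (f (y t)) (Set.Icc t₀ T) t)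
    {R : ℝ} (hR : 0 < R) :
    ∃ C₁, ∀ᶠ h in nhdsWithin (0 : ℝ) (Set.Ioi 0), IsUnit (gram φ t₀ h).det ∧ ∃ u : ℝ → E,
      (∀ τ ∈ Set.Icc (0 : ℝ) 1, u τ ∈ Metric.closedBall (y t₀) R) ∧
      (∀ τ, u τ = y t₀ + h • ∫ α in (0 : ℝ)..τ, proj φ t₀ h (fun σ => f (u σ)) α) ∧
      (∀ v : ℝ → E, ContinuousOn v (Set.Icc 0 1) →
        (∀ τ ∈ Set.Icc (0 : ℝ) 1, v τ ∈ Metric.closedBall (y t₀) R) →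
        (∀ τ ∈ Set.Icc (0 : ℝ) 1,
          v τ = y t₀ + h • ∫ α in (0 : ℝ)..τ, proj φ t₀ h (fun σ => f (v σ)) α) →
        Set.EqOn v u (Set.Icc 0 1)) ∧
      (∀ τ ∈ Set.Icc (0 : ℝ) 1, ‖u τ - y (t₀ + τ * h)‖ ≤ C₁ * h ^ (r + 1)) ∧
      ‖u 1 - y (t₀ + h)‖ ≤ C₁ * h ^ (2 * r + 1) := by
  obtain ⟨K, hK0, hKev⟩ := exists_kernel_bound hφ hS hC hSC
  have hyc : ContinuousOn y (Set.Icc t₀ T) := fun t ht => (hy t ht).continuousWithinAt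
  obtain ⟨R₁, hR₁⟩ := isCompact_Icc.exists_bound_of_continuousOn
    (hyc.sub (continuousOn_const (c := y t₀)))
  -- The larger ball also contains the whole exact trajectory; constants are taken there, while the
  -- fixed point is sought in the ball of radius `R`.
  let R' := max R R₁
  have hys : ∀ t ∈ Set.Icc t₀ T, y t ∈ Metric.closedBall (y t₀) R' := fun t ht =>
    mem_closedBall_iff_norm.2 ((hR₁ t ht).trans (le_max_right _ _))
  have hRR' : Metric.closedBall (y t₀) R ⊆ Metric.closedBall (y t₀) R' :=
    Metric.closedBall_subset_closedBall (le_max_left _ _)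
  have hy1 : ContDiffOn ℝ r y (Set.Icc t₀ T) := by
    refine (contDiffOn_of_hasDerivWithinAt hf (uniqueDiffOn_Icc hT) hy).of_le ?_
    exact_mod_cast Nat.le_succ r
  have hfr : ContDiff ℝ r f := hf.of_le (by exact_mod_cast Nat.le_succ r)
  have hf1 : ContDiff ℝ 1 f := hf.of_le (by exact_mod_cast Nat.succ_le_succ (Nat.zero_le r))
  have hfc : ContinuousOn f (Metric.closedBall (y t₀) R') := hf.continuous.continuousOn
  obtain ⟨L, hL0, hL⟩ := exists_lipschitz_on_closedBall hf1 (y t₀) R'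
  obtain ⟨M, hM⟩ := (isCompact_closedBall (y t₀) R').exists_bound_of_continuousOn hfc
  obtain ⟨cg, Bg, hBg0, hBg⟩ := exists_approx hC hT hSC (hfr.comp_contDiffOn hy1)
  let Ce := 2 * (K + 1) * Bg
  have hCe : 0 ≤ Ce := by positivity
  have hend : ∃ C₂, 0 ≤ C₂ ∧ ∀ᶠ h in nhdsWithin (0 : ℝ) (Set.Ioi 0), ∀ u : ℝ → E,
      IsUnit (gram φ t₀ h).det →
      (∀ τ ∈ Set.Icc (0 : ℝ) 1, ∀ σ ∈ Set.Icc (0 : ℝ) 1, |kernelP φ t₀ h τ σ| ≤ K) →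
      ContinuousOn u (Set.Icc 0 1) →
      (∀ τ ∈ Set.Icc (0 : ℝ) 1, u τ ∈ Metric.closedBall (y t₀) R') →
      (∀ τ ∈ Set.Icc (0 : ℝ) 1,
        u τ = y t₀ + h • ∫ α in (0 : ℝ)..τ, proj φ t₀ h (fun σ => f (u σ)) α) →
      (∀ τ ∈ Set.Icc (0 : ℝ) 1, ‖u τ - y (t₀ + τ * h)‖ ≤ Ce * h ^ (r + 1)) →
      ‖u 1 - y (t₀ + h)‖ ≤ C₂ * h ^ (2 * r + 1) := by
    rcases Nat.eq_zero_or_pos r with rfl | hr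
    -- For `r = 0` both exponents equal 1, so the stage bound at `τ = 1` is enough.
    · refine ⟨Ce, hCe, Filter.Eventually.of_forall fun h u _ _ _ _ _ hs => ?_⟩
      simpa using hs 1 ⟨zero_le_one, le_rfl⟩
    · exact exists_endpoint_bound hr hφ hC hSC hf hT hy hys hK0 hCe
  obtain ⟨C₂, hC₂0, hC₂⟩ := hend
  refine ⟨max Ce C₂, ?_⟩
  filter_upwards [hKev, hC₂, eventually_step_small (a := K * M) hR,
    eventually_step_small (a := K * L) (b := 1 / 2) (by norm_num), Ioc_mem_nhdsGT one_pos,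
    Ioc_mem_nhdsGT (sub_pos.2 hT)] with h hKh hCh hhM hhL hh1 hhT'
  have hh : 0 < h := hh1.1
  have hhT : t₀ + h ≤ T := by linarith [hhT'.2]
  have hhL1 : h * (K * L) < 1 := by linarith
  obtain ⟨u, hus, hue⟩ := exists_proj_solution hφ hKh.2 hR.le (hfc.mono hRR')
    (fun x hx x' hx' => hL x (hRR' hx) x' (hRR' hx')) hL0 (fun x hx => hM x (hRR' hx)) hh.le
    hhM hhL1
  have huc : Continuous u := by
    rw [funext hue]
    exact continuous_const.add ((intervalIntegral.continuous_primitive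
      (fun a b => (continuous_proj hφ _).intervalIntegrable a b) 0).const_smul h)
  have hstage : ∀ τ ∈ Set.Icc (0 : ℝ) 1, ‖u τ - y (t₀ + τ * h)‖ ≤ Ce * h ^ (r + 1) := by
    intro τ hτ
    refine (stage_error_le (B := Bg * h ^ r) (c := cg) hφ hKh.1 hKh.2 hfc hL hL0 hy hys hh hhT hhL
      (fun σ hσ => ?_) huc.continuousOn (fun τ hτ => hRR' (hus τ hτ)) (fun τ _ => hue τ)
      τ hτ).trans (le_of_eq ?_)
    · refine (hBg _ (affine_mem_Icc hh.le hhT hσ)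
        (affine_mem_Icc (T := t₀ + 1) hh.le (by linarith [hh1.2]) hσ).2).trans ?_
      rw [add_sub_cancel_left]
      exact mul_le_mul_of_nonneg_left (pow_le_pow_left₀ (mul_nonneg hσ.1 hh.le)
        (mul_le_of_le_one_left hh.le hσ.2) r) hBg0
    · simp only [Ce]
      ring
  refine ⟨hKh.1, u, hus, hue, fun v hvc hvs hve => ?_, fun τ hτ => ?_, ?_⟩
  · exact eqOn_of_proj_solution hφ hKh.2 hfc hL hL0 hh.le hhL1 hvc
      (fun τ hτ => hRR' (hvs τ hτ)) hve huc.continuousOn (fun τ hτ => hRR' (hus τ hτ))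
      fun τ _ => hue τ
  · exact (hstage τ hτ).trans (mul_le_mul_of_nonneg_right (le_max_left _ _) (by positivity))
  · exact (hCh u hKh.1 hKh.2 huc.continuousOn (fun τ hτ => hRR' (hus τ hτ)) (fun τ _ => hue τ)
      hstage).trans (mul_le_mul_of_nonneg_right (le_max_right _ _) (by positivity))

end Order

/-! ### Application to the Hamiltonian vector field. -/

theorem contDiff_hamiltonianField {d₁ : ℕ} {H : Phase d₁ → ℝ} {n : ℕ}
    (hH : ContDiff ℝ ((n + 1 : ℕ) : WithTop ℕ∞) H) :
    ContDiff ℝ (n : WithTop ℕ∞) (hamiltonianField H) := by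
  have hgrad : ContDiff ℝ (n : WithTop ℕ∞) (gradient H) :=
    (InnerProductSpace.toDual ℝ (Phase d₁)).symm.contDiff.comp
      (hH.fderiv_right (m := (n : WithTop ℕ∞)) (by norm_cast))
  have hlin := (LinearMap.toContinuousLinearMap
    (Matrix.toEuclideanLin (symplecticJ d₁)⁻¹)).contDiff (n := (n : WithTop ℕ∞))
  exact hlin.comp hgrad

end FFCFE

theorem mainTheorem1 (d₁ r : ℕ) (H : FFCFE.Phase d₁ → ℝ)
    (hH : ContDiff ℝ ((r + 2 : ℕ) : WithTop ℕ∞) H)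
    (φ : Fin r → ℝ → ℝ)
    (hφ : ∀ i, ContDiff ℝ ((r : ℕ) : WithTop ℕ∞) (φ i))
    (hli : LinearIndependent ℝ φ)
    (hinv : FFCFE.TranslationReflectionInvariant (FFCFE.spaceY d₁ φ))
    (t₀ T : ℝ) (hT : t₀ < T) (y₀ : FFCFE.Phase d₁) (y : ℝ → FFCFE.Phase d₁)
    (hy : FFCFE.IsIVPSolution (FFCFE.hamiltonianField H) t₀ T y₀ y)
    (R : ℝ) (hR : 0 < R) :
    ∃ h₀ > 0, h₀ ≤ T - t₀ ∧ ∃ C : ℝ, ∀ h : ℝ, 0 < h → h ≤ h₀ →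
      ∃ u : ℝ → FFCFE.Phase d₁,
        FFCFE.IsVariationalSolution φ (FFCFE.hamiltonianField H) t₀ h y₀ u ∧
        FFCFE.IsContinuousStageSolution φ (FFCFE.hamiltonianField H) t₀ h y₀ u ∧
        (∀ τ ∈ Set.Icc (0 : ℝ) 1, ‖u τ - y₀‖ ≤ R) ∧
        (∀ v : ℝ → FFCFE.Phase d₁,
          (FFCFE.IsVariationalSolution φ (FFCFE.hamiltonianField H) t₀ h y₀ v ∨
            FFCFE.IsContinuousStageSolution φ (FFCFE.hamiltonianField H) t₀ h y₀ v) →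
          (∀ τ ∈ Set.Icc (0 : ℝ) 1, ‖v τ - y₀‖ ≤ R) →
          Set.EqOn v u (Set.Icc 0 1)) ∧
        (∀ τ ∈ Set.Ioo (0 : ℝ) 1, ‖u τ - y (t₀ + τ * h)‖ ≤ C * h ^ (r + 1)) ∧
        ‖u 1 - y (t₀ + h)‖ ≤ C * h ^ (2 * r + 1) := by
  -- When `d₁ = 0` the phase space is a point: the invariance says nothing about the `φ i`, but all
  -- equations and bounds are trivial.
  rcases Nat.eq_zero_or_pos d₁ with rfl | hd
  · refine ⟨T - t₀, sub_pos.2 hT, le_rfl, 0, fun h _ _ => ⟨fun _ => 0, ⟨⟨fun _ => 0,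
      ⟨0, 0, fun t => Subsingleton.elim _ _⟩, fun _ => rfl⟩, Subsingleton.elim _ _,
      fun v _ => Subsingleton.elim _ _⟩, ⟨continuousOn_const, fun _ _ => Subsingleton.elim _ _⟩,
      fun τ _ => ?_, fun v _ _ τ _ => Subsingleton.elim _ _, fun τ _ => ?_, ?_⟩⟩
    · rw [Subsingleton.elim (_ - _) (0 : FFCFE.Phase 0), norm_zero]
      exact hR.le
    · rw [Subsingleton.elim (_ - _) (0 : FFCFE.Phase 0), norm_zero, zero_mul]
    · rw [Subsingleton.elim (_ - _) (0 : FFCFE.Phase 0), norm_zero, zero_mul]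
  obtain ⟨hy0, hyd⟩ := hy
  subst hy0
  have hφc : ∀ i, Continuous (φ i) := fun i => (hφ i).continuous
  have hf := FFCFE.contDiff_hamiltonianField hH
  obtain ⟨S, hS, C, hC, hSC⟩ := FFCFE.exists_monomial_like_basis hφ hli
    (FFCFE.exists_translate_eq_sum hd hinv) t₀
  obtain ⟨C₁, hev⟩ := FFCFE.exists_local_error_bound hφc hS hC hSC hf hT hyd hR
  obtain ⟨h₁, hh₁, hsub⟩ := mem_nhdsGT_iff_exists_Ioc_subset.1 hev
  refine ⟨min h₁ (T - t₀), lt_min hh₁ (sub_pos.2 hT), min_le_right _ _, C₁, fun h hh hle => ?_⟩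
  obtain ⟨hM, u, hus, hue, huniq, hstage, hend⟩ := hsub ⟨hh, hle.trans (min_le_left _ _)⟩
  have hvar := fun v : ℝ → FFCFE.Phase d₁ => FFCFE.isVariationalSolution_iff
    (y₀ := y t₀) (u := v) hφc hf.continuous hh.ne' hM
  have hcs := fun v : ℝ → FFCFE.Phase d₁ => FFCFE.isContinuousStageSolution_iff
    (t₀ := t₀) (h := h) (y₀ := y t₀) (u := v) hφc hf.continuous
  have huc : Continuous u := by
    rw [funext hue]
    exact continuous_const.add ((intervalIntegral.continuous_primitive
      (fun a b => (FFCFE.continuous_proj hφc _).intervalIntegrable a b) 0).const_smul h)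
  refine ⟨u, (hvar u).2 ⟨huc, hue⟩, (hcs u).2 ⟨huc.continuousOn, fun τ _ => hue τ⟩,
    fun τ hτ => mem_closedBall_iff_norm.1 (hus τ hτ), fun v hv hvR => ?_,
    fun τ hτ => hstage τ (Set.Ioo_subset_Icc_self hτ), hend⟩
  have hv' : ContinuousOn v (Set.Icc 0 1) ∧ ∀ τ ∈ Set.Icc (0 : ℝ) 1, v τ = y t₀ + h •
      ∫ α in (0 : ℝ)..τ, FFCFE.proj φ t₀ h (fun σ => FFCFE.hamiltonianField H (v σ)) α := by
    rcases hv with hv | hv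
    · obtain ⟨hvc, hve⟩ := (hvar v).1 hv
      exact ⟨hvc.continuousOn, fun τ _ => hve τ⟩
    · exact (hcs v).1 hv
  exact huniq v hv'.1 (fun τ hτ => mem_closedBall_iff_norm.2 (hvR τ hτ)) hv'.2
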